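/- Let $n\ge 1$, and let $\mathbb H$ be the real quaternions with units $i,j,k$. For $g\in L^1\cap L^2(\mathbb R^{2n},\mathbb H)$ let $$\mathcal F_Q(g)(u,v)=\int_{\mathbb R^n\times\mathbb R^n}e^{-2\pi i\,u\cdot x}\,g(x,y)\,e^{-2\pi j\,v\cdot y}\,dx\,dy ,\qquad (u,v)\in\mathbb R^n\times\mathbb R^n,$$ be the two-sided quaternion Fourier transform, extended by continuity to $L^2(\mathbb R^{2n},\mathbb H)$. For $a\in\mathbb R^*=\mathbb R\setminus\{0\}$ and $s\in\mathbb R^{2n-1}$ put $$A_a=\begin{pmatrix}a&0\\0&\operatorname{sgn}(a)|a|^{\frac1{2n}}I_{2n-1}\end{pmatrix},\qquad S_s=\begin{pmatrix}1&s^T\\0&I_{2n-1}\end{pmatrix},$$ and for $\psi\in L^2(\mathbb R^{2n},\mathbb H)$ and $t\in\mathbb R^{2n}$ put $\psi_{a,s,t}(x)=|a|^{\frac1{4n}-1}\psi\big(A_a^{-1}S_s^{-1}(x-t)\big)$ and $\psi^*(x)=\overline{\psi(-x)}$. The function $\psi$ is called an admissible quaternion shearlet if $$C_\psi=\int_{\mathbb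 R^{2n}}\frac{|\mathcal F_Q(\psi^*)(\lambda)|^2}{|\lambda_1|^{2n}}\,d\lambda<\infty .$$ Let $d\mu(a,s,t)=|a|^{-(2n+1)}\,da\,ds\,dt$ on $\mathbb R^*\times\mathbb R^{2n-1}\times\mathbb R^{2n}$, and for $f\in L^2(\mathbb R^{2n},\mathbb H)$ let $$\mathcal{SH}^Q_\psi(f)(a,s,t)=\int_{\mathbb R^{2n}}f(x)\,\overline{\psi_{a,s,t}(x)}\,dx .$$ Let $\psi\neq0$ be an admissible quaternion shearlet, let $f\in L^2(\mathbb R^{2n},\mathbb H)$ with $f\ne0$, let $\Sigma\subseteq\mathbb R^*\times\mathbb R^{2n-1}\times\mathbb R^{2n}$ be measurable and let $0\le\xi\le1$. If $\mathcal{SH}^Q_\psi(f)$ is $\xi$-concentrated on $\Sigma$, that is, $$\Big(\int_{\Sigma^c}|\mathcal{SH}^Q_\psi(f)|^2\,d\mu\Big)^{1/2}\le\xi\,\|\mathcal{SH}^Q_\psi(f)\|_{L^2(d\mu)},$$ then for every real $p>2$ $$\mu(\Sigma)\ \ge\ (1-\xi^2)^{\frac p{p-2}}\ \frac{C_\psi}{\|\psi\|_2^2}.$$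 -/

import Mathlib

namespace QuatShearlet

open MeasureTheory
open scoped Quaternion ENNReal

noncomputable section

/-- The space `ℝ^{2n}` with its Euclidean structure and Lebesgue measure. -/
abbrev Space (n : ℕ) : Type := EuclideanSpace ℝ (Fin (2 * n))

/-- The quaternionic Lebesgue space `L²(ℝ^{2n}, ℍ)`. -/
abbrev L2H (n : ℕ) : Type := Lp ℍ[ℝ] 2 (volume : Measure (Space n))

/-- The quaternion unit `i`. -/
def qI : ℍ[ℝ] := ⟨0, 1, 0, 0⟩

/-- The quaternion unit `j`. -/
def qJ : ℍ[ℝ] := ⟨0, 0, 1, 0⟩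

/-! ### The two-sided quaternion Fourier transform -/

/-- `u · x` for `w = (u, v)` and `z = (x, y)` in `ℝ^n × ℝ^n = ℝ^{2n}`. -/
def dotFst {n : ℕ} (w z : Space n) : ℝ :=
  ∑ k ∈ Finset.univ.filter (fun k : Fin (2 * n) => (k : ℕ) < n), w k * z k

/-- `v · y` for `w = (u, v)` and `z = (x, y)` in `ℝ^n × ℝ^n = ℝ^{2n}`. -/
def dotSnd {n : ℕ} (w z : Space n) : ℝ :=
  ∑ k ∈ Finset.univ.filter (fun k : Fin (2 * n) => n ≤ (k : ℕ)), w k * z k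

/-- The integral
`F_Q(f)(u, v) = ∫ e^{-2π i u·x} f(x, y) e^{-2π j v·y} dx dy`, meaningful for integrable `f`. -/
def qftIntegral {n : ℕ} (f : Space n → ℍ[ℝ]) (w : Space n) : ℍ[ℝ] :=
  ∫ z : Space n,
    NormedSpace.exp ((-(2 * Real.pi * dotFst w z)) • qI) * f z *
      NormedSpace.exp ((-(2 * Real.pi * dotSnd w z)) • qJ)

open Classical in
/-- The integral transform as a map into `L²`; it is used only on `L¹ ∩ L²`, where the first
branch always applies by Plancherel's formula. -/
def qftL1L2 {n : ℕ} (f : L2H n) : L2H n :=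
  if h : MemLp (qftIntegral f) 2 (volume : Measure (Space n)) then h.toLp (qftIntegral f) else 0

/-- The quaternion Fourier transform on `L²(ℝ^{2n}, ℍ)`: the extension by continuity of the
integral transform from the dense subspace `L¹ ∩ L²`. -/
def qft {n : ℕ} : L2H n → L2H n :=
  extendFrom {f : L2H n | Integrable f (volume : Measure (Space n))} qftL1L2

/-! ### Admissible shearlets -/

theorem memLp_reflConj {n : ℕ} (ψ : L2H n) :
    MemLp (fun x : Space n => star (ψ (-x))) 2 (volume : Measure (Space n)) := by
  have h1 : MemLp (fun x : Space n => ψ (-x)) 2 (volume : Measure (Space n)) :=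
    (Lp.memLp ψ).comp_measurePreserving (Measure.measurePreserving_neg volume)
  exact h1.star

/-- `ψ*(x) = conj (ψ(-x))`. -/
def reflConj {n : ℕ} (ψ : L2H n) : L2H n := (memLp_reflConj ψ).toLp _

/-- `C_ψ = ∫ |F_Q(ψ*)(λ)|² / |λ₁|^{2n} dλ`, as an extended nonnegative number. -/
def admConst {n : ℕ} [NeZero n] (ψ : L2H n) : ℝ≥0∞ :=
  ∫⁻ w : Space n, ‖qft (reflConj ψ) w‖ₑ ^ 2 / ‖w 0‖ₑ ^ (2 * n)

/-- `ψ` is an admissible quaternion shearlet: `C_ψ < ∞`. -/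
def Admissible {n : ℕ} [NeZero n] (ψ : L2H n) : Prop := admConst ψ < ∞

/-! ### The shearlet transform -/

/-- The parameter set `ℝ^* × ℝ^{2n-1} × ℝ^{2n}`. -/
abbrev Param (n : ℕ) : Type := {a : ℝ // a ≠ 0} × EuclideanSpace ℝ (Fin (2 * n - 1)) × Space n

/-- The left Haar measure `dμ = |a|^{-(2n+1)} da ds dt` on `ℝ^* × ℝ^{2n-1} × ℝ^{2n}`. -/
def haarMeasure (n : ℕ) : Measure (Param n) :=
  (((volume : Measure ℝ).comap Subtype.val).prod (volume.prod volume)).withDensity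
    fun q => ENNReal.ofReal (1 / |(q.1 : ℝ)| ^ (2 * n + 1))

/-- The dilation matrix `A_a = diag(a, sg(a)|a|^{1/(2n)}, …, sg(a)|a|^{1/(2n)})`. -/
def dilMatrix (n : ℕ) (a : ℝ) : Matrix (Fin (2 * n)) (Fin (2 * n)) ℝ :=
  Matrix.diagonal fun k =>
    if (k : ℕ) = 0 then a else Real.sign a * |a| ^ (1 / (2 * (n : ℝ)))

/-- The shear matrix `S_s`: the identity matrix with first row `(1, s₁, …, s_{2n-1})`. -/
def shearMatrix (n : ℕ) (s : EuclideanSpace ℝ (Fin (2 * n - 1))) :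
    Matrix (Fin (2 * n)) (Fin (2 * n)) ℝ :=
  Matrix.of fun k l =>
    if k = l then 1
    else if (k : ℕ) = 0 then s ⟨(l : ℕ) - 1, by have := l.isLt; omega⟩
    else 0

/-- `ψ_{a,s,t}(x) = |a|^{1/(4n) - 1} ψ(A_a⁻¹ S_s⁻¹ (x - t))`. -/
def shearlet {n : ℕ} (ψ : Space n → ℍ[ℝ]) (q : Param n) (x : Space n) : ℍ[ℝ] :=
  (|(q.1 : ℝ)| ^ (1 / (4 * (n : ℝ)) - 1)) •
    ψ (Matrix.toEuclideanLin ((dilMatrix n q.1)⁻¹ * (shearMatrix n q.2.1)⁻¹) (x - q.2.2))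

/-- The continuous quaternion shearlet transform
`SH_ψ(f)(a,s,t) = ∫ f(x) conj (ψ_{a,s,t}(x)) dx`. -/
def shearletTransform {n : ℕ} (ψ f : L2H n) (q : Param n) : ℍ[ℝ] :=
  ∫ x : Space n, f x * star (shearlet ψ q x)

/-- `F` (in `L²(dμ)`) is `ξ`-concentrated on `S`:
`(∫_{Sᶜ} |F|² dμ)^{1/2} ≤ ξ ‖F‖_{2,μ}`. -/
def Concentrated {n : ℕ} (ξ : ℝ) (F : Param n → ℍ[ℝ]) (S : Set (Param n)) : Prop :=
  (∫⁻ q in Sᶜ, ‖F q‖ₑ ^ 2 ∂(haarMeasure n)) ^ (1 / 2 : ℝ) ≤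
    ENNReal.ofReal ξ * (∫⁻ q, ‖F q‖ₑ ^ 2 ∂(haarMeasure n)) ^ (1 / 2 : ℝ)

end

end QuatShearlet

/-!
Every value of the shearlet transform pairs `f` with a shearlet of norm `‖ψ‖`, so
`|SH|² ≤ ‖f‖² ‖ψ‖²` pointwise (`enorm_shearletTransform_le`). The transform also satisfies the
Plancherel formula `∫ |SH|² dμ = C_ψ ‖f‖²` (`lintegral_shearletTransform`). Concentration on `S`
says that at least the fraction `1 - ξ²` of this finite integral comes from `S`; hence
`(1 - ξ²) C_ψ ‖f‖² ≤ ‖f‖² ‖ψ‖² μ(S)`, and `p / (p - 2) ≥ 1` together with `0 ≤ 1 - ξ² ≤ 1` gives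
the claimed bound.

The Plancherel formula is not a formal consequence of a convolution theorem, as the two-sided
transform has none. Quaternions are embedded in `ℍ ⊗ ℂ = ℂ⁴`, and `hat f` denotes the ordinary `L²`
Fourier transform there. By Parseval, `t ↦ SH(a, s, t)` is the inverse Fourier transform of the
product of `hat f` with the conjugate of a rescaled `hat ψ` (`complexify_shearletTransform`), and
the orbit of a frequency under the shearlet group turns Haar measure into `dv / |v₁|^{2n}`
(`lintegral_freqAct`). The norm of `ℍ ⊗ ℂ` is not multiplicative, but
`|u v*|² + |u conj(v)*|² = 2 |u|² |v|²` (`norm_mulStar_add_conj`). Since the components of `ψ` are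
real, `hat ψ (-w)` is the complex conjugate of `hat ψ w`, and the weight is even, so the defect of
multiplicativity integrates to zero (`lintegral_symmetrize`, `lintegral_mulStar`).

The same symmetry identifies `C_ψ`. The space `ℍ` splits orthogonally into the eigenspaces of
`q ↦ i q j`, on which the two-sided kernel is a character in `(u, v)` and in `(-u, v)` respectively
(`exp_mul_mul_exp`); thus `qft` is built from `hat` (`qft_eq`), and integrals of `|qft f|²` and
`|hat f|²` against weights invariant under the reflections agree (`lintegral_qft`).
-/

/-! ### The Fourier transform on `L²` -/

namespace L2Fourier

open MeasureTheory FourierTransform Filter Topology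
open scoped ENNReal RealInnerProductSpace

noncomputable section

variable {V E F : Type*} [NormedAddCommGroup V] [InnerProductSpace ℝ V] [FiniteDimensional ℝ V]
  [MeasurableSpace V] [BorelSpace V]
  [NormedAddCommGroup E] [InnerProductSpace ℂ E] [CompleteSpace E]
  [NormedAddCommGroup F] [InnerProductSpace ℂ F] [CompleteSpace F]

omit [CompleteSpace E] in
theorem continuous_fourier_of_integrable {φ : V → E} (hφ : Integrable φ) :
    Continuous (𝓕 φ) :=
  VectorFourier.fourierIntegral_continuous Real.continuous_fourierChar
    (by exact continuous_inner) hφ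

/-- On `L¹ ∩ L²` the `L²` Fourier transform is given by the Fourier integral: both represent the
same tempered distribution. -/
theorem fourier_ae_eq (φ : Lp E 2 (volume : Measure V)) (hφ : Integrable φ) :
    (𝓕 φ : Lp E 2 (volume : Measure V)) =ᵐ[volume] 𝓕 (φ : V → E) := by
  apply ae_eq_of_integral_contDiff_smul_eq
  · exact (Lp.memLp _).locallyIntegrable (by norm_num)
  · exact (continuous_fourier_of_integrable hφ).locallyIntegrable
  intro g g_smooth g_cpt
  have hg₁ : HasCompactSupport (Complex.ofRealCLM ∘ g) := g_cpt.comp_left rfl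
  have hg₂ : ContDiff ℝ (⊤ : ℕ∞) (Complex.ofRealCLM ∘ g) := by fun_prop
  set G := hg₁.toSchwartzMap hg₂ with hG
  have hGi : Integrable (G : V → ℂ) := G.integrable
  have h1 := congrArg (fun T => T G) (Lp.fourier_toTemperedDistribution_eq φ)
  simp only [TemperedDistribution.fourier_apply, Lp.toTemperedDistribution_apply] at h1
  have h2 := VectorFourier.integral_fourierIntegral_smul_eq_flip (L := innerₗ V)
    (f := (G : V → ℂ)) (g := (φ : V → E)) Real.continuous_fourierChar
    (by exact continuous_inner) hGi hφ
  rw [flip_innerₗ] at h2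
  have h3 : ∀ x, (G x : ℂ) = (g x : ℂ) := fun x => by simp [hG]
  calc _ = ∫ x, G x • (𝓕 φ : Lp E 2 (volume : Measure V)) x := by simp [h3]
    _ = ∫ x, 𝓕 (G : V → ℂ) x • φ x := h1.symm
    _ = ∫ x, G x • 𝓕 (φ : V → E) x := h2
    _ = _ := by simp [h3]

/-- `L¹ ∩ L²` is dense in `L²`, since it contains the simple functions. -/
theorem dense_integrable {α G : Type*} [MeasurableSpace α] {μ : Measure α}
    [NormedAddCommGroup G] : Dense {f : Lp G 2 μ | Integrable f μ} := by
  have h := Lp.simpleFunc.dense (E := G) (p := 2) (μ := μ) (by norm_num)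
  refine h.mono ?_
  intro f hf
  obtain ⟨s, hs⟩ := hf
  have hL : MemLp s 2 μ := by
    have : MemLp (f : α → G) 2 μ := Lp.memLp f
    refine this.ae_eq ?_
    rw [← hs]
    exact AEEqFun.coeFn_mk _ _
  have hi := (SimpleFunc.memLp_iff_integrable (by norm_num) (by norm_num)).1 hL
  refine hi.congr ?_
  rw [← hs]
  exact (AEEqFun.coeFn_mk _ _).symm

theorem fourier_compLpL (A : E →L[ℂ] F) (u : Lp E 2 (volume : Measure V)) :
    𝓕 (A.compLpL 2 volume u) = A.compLpL 2 volume (𝓕 u) := by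
  refine dense_integrable.induction (P := fun u => 𝓕 (A.compLpL 2 volume u) =
    A.compLpL 2 volume (𝓕 u)) ?_ ?_ u
  · intro u hu
    have hA := A.coeFn_compLpL u
    have hAi : Integrable (A.compLpL 2 volume u) := (A.integrable_comp hu).congr hA.symm
    apply Lp.ext
    refine (fourier_ae_eq _ hAi).trans ?_
    filter_upwards [A.coeFn_compLpL (𝓕 u), fourier_ae_eq u hu] with w h1 h2
    rw [h1, h2, Real.fourier_congr_ae hA]
    rw [Real.fourier_eq, Real.fourier_eq, ← A.integral_comp_comm]
    · congr 1; ext v; simp [Circle.smul_def]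
    · exact (Real.fourierIntegral_convergent_iff w).2 hu
  · exact isClosed_eq (continuous_fourier.comp (A.compLpL 2 volume).continuous)
      ((A.compLpL 2 volume).continuous.comp continuous_fourier)

/-- Plancherel's formula for the inverse Fourier integral on `L¹ ∩ L²`. -/
theorem eLpNorm_fourierInv (h : V → E) (hi : Integrable h) (h2 : MemLp h 2) :
    eLpNorm (𝓕⁻ h) 2 volume = eLpNorm h 2 volume := by
  have e : (h2.toLp h : V → E) =ᵐ[volume] h := h2.coeFn_toLp
  have h4 := fourier_ae_eq (h2.toLp h) (hi.congr e.symm)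
  have h5 : 𝓕 (h2.toLp h : V → E) = 𝓕 h := by ext w; exact Real.fourier_congr_ae e w
  have h6 : 𝓕⁻ h = 𝓕 h ∘ Neg.neg := by ext w; exact Real.fourierInv_eq_fourier_neg h w
  rw [h6, eLpNorm_comp_measurePreserving
    (continuous_fourier_of_integrable hi).aestronglyMeasurable
    (Measure.measurePreserving_neg volume), ← h5, ← eLpNorm_congr_ae h4, ← eLpNorm_congr_ae e]
  have := Lp.norm_fourier_eq (h2.toLp h)
  rw [Lp.norm_def, Lp.norm_def] at this
  exact (ENNReal.toReal_eq_toReal_iff' (Lp.eLpNorm_ne_top _) (Lp.eLpNorm_ne_top _)).1 this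

/-! ### Affine changes of variable -/

theorem map_volume (L : V ≃L[ℝ] V) :
    Measure.map L (volume : Measure V) =
      ENNReal.ofReal |(LinearMap.det (L : V →ₗ[ℝ] V))|⁻¹ • volume := by
  have hdet : LinearMap.det (L : V →ₗ[ℝ] V) ≠ 0 := (LinearEquiv.isUnit_det' L.toLinearEquiv).ne_zero
  have := Measure.map_linearMap_addHaar_eq_smul_addHaar (volume : Measure V) hdet
  rw [abs_inv] at this
  exact this

theorem lintegral_comp (L : V ≃L[ℝ] V) (g : V → ℝ≥0∞) :
    ∫⁻ x, g (L x) = ENNReal.ofReal |(LinearMap.det (L : V →ₗ[ℝ] V))|⁻¹ * ∫⁻ y, g y := by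
  have h := (L.toHomeomorph.measurableEmbedding).lintegral_map (μ := (volume : Measure V)) g
  have h2 : Measure.map (L.toHomeomorph) (volume : Measure V) = _ := map_volume L
  rw [h2, lintegral_smul_measure] at h
  exact h.symm

theorem integral_comp {G : Type*} [NormedAddCommGroup G] [NormedSpace ℝ G]
    (L : V ≃L[ℝ] V) (g : V → G) :
    ∫ x, g (L x) = |(LinearMap.det (L : V →ₗ[ℝ] V))|⁻¹ • ∫ y, g y := by
  have h := (L.toHomeomorph.measurableEmbedding).integral_map (μ := (volume : Measure V)) g
  have h2 : Measure.map (L.toHomeomorph) (volume : Measure V) = _ := map_volume L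
  rw [h2, integral_smul_measure, ENNReal.toReal_ofReal (by positivity)] at h
  exact h.symm

theorem quasiMeasurePreserving (L : V ≃L[ℝ] V) :
    Measure.QuasiMeasurePreserving L (volume : Measure V) volume := by
  refine ⟨L.continuous.measurable, ?_⟩
  rw [map_volume]
  exact Measure.smul_absolutelyContinuous

theorem memLp_comp {G : Type*} [NormedAddCommGroup G] (L : V ≃L[ℝ] V) {g : V → G} {p : ℝ≥0∞}
    (hg : MemLp g p) : MemLp (fun x => g (L x)) p (volume : Measure V) := by
  have h2 : Measure.map (L.toHomeomorph) (volume : Measure V) = _ := map_volume L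
  have := (L.toHomeomorph.measurableEmbedding).memLp_map_measure_iff (μ := (volume : Measure V))
    (g := g) (p := p)
  rw [h2] at this
  exact this.1 (hg.smul_measure ENNReal.ofReal_ne_top)

omit [CompleteSpace E] in
/-- The Fourier integral of an affine substitution, for `L'` the adjoint of `L`. -/
theorem fourier_comp_affine (L L' : V ≃L[ℝ] V) (hadj : ∀ y w, ⟪L y, w⟫ = ⟪y, L' w⟫)
    (t : V) (φ : V → E) (w : V) :
    𝓕 (fun y => φ (L y + t)) (L' w) =
      |LinearMap.det (L : V →ₗ[ℝ] V)|⁻¹ • Real.fourierChar ⟪t, w⟫ • 𝓕 φ w := by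
  rw [Real.fourier_eq]
  have h1 : ∀ v, Real.fourierChar (-⟪v, L' w⟫) • φ (L v + t) =
      (fun x => Real.fourierChar ⟪t, w⟫ • Real.fourierChar (-⟪x + t, w⟫) • φ (x + t)) (L v) := by
    intro v
    simp only [← hadj, inner_add_left, smul_smul, ← AddChar.map_add_eq_mul]
    congr 2; ring_nf
  simp_rw [h1]
  rw [integral_comp L (fun x => Real.fourierChar ⟪t, w⟫ •
    Real.fourierChar (-⟪x + t, w⟫) • φ (x + t))]
  congr 1
  simp_rw [Circle.smul_def]
  rw [integral_smul, Real.fourier_eq]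
  congr 1
  exact integral_add_right_eq_self (fun x => (Real.fourierChar (-⟪x, w⟫) : ℂ) • φ x) t

/-- Covariance of the `L²` Fourier transform under affine changes of variable. -/
theorem fourier_affine (L L' : V ≃L[ℝ] V) (hadj : ∀ y w, ⟪L y, w⟫ = ⟪y, L' w⟫)
    (hdet : |LinearMap.det (L' : V →ₗ[ℝ] V)| = |LinearMap.det (L : V →ₗ[ℝ] V)|)
    (t : V) (u uT : Lp E 2 (volume : Measure V))
    (hu : uT =ᵐ[volume] fun x => u (L.symm (x - t))) :
    (𝓕 uT : Lp E 2 (volume : Measure V)) =ᵐ[volume] fun w =>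
      |LinearMap.det (L : V →ₗ[ℝ] V)| • Real.fourierChar (-⟪t, w⟫) •
        (𝓕 u : Lp E 2 (volume : Measure V)) (L' w) := by
  set d := |LinearMap.det (L : V →ₗ[ℝ] V)| with hd
  have hd0 : d ≠ 0 := by
    rw [hd, abs_ne_zero]; exact (LinearEquiv.isUnit_det' L.toLinearEquiv).ne_zero
  have hh : MemLp (fun w => d • Real.fourierChar (-⟪t, w⟫) •
        (𝓕 u : Lp E 2 (volume : Measure V)) (L' w)) 2 volume := by
    refine MemLp.const_smul ?_ d
    have h1 := memLp_comp L' (Lp.memLp (𝓕 u : Lp E 2 (volume : Measure V)))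
    have hc : Continuous fun w : V => (Real.fourierChar (-⟪t, w⟫) : ℂ) := by
      have := Real.continuous_fourierChar; fun_prop
    refine h1.of_le (hc.aestronglyMeasurable.smul h1.1) ?_
    filter_upwards with w
    simp
  -- By unitarity it is enough to pair with `𝓕 φ` for `φ` in `L¹ ∩ L²`, where the substitution can
  -- be carried out in the Fourier integral of `φ`.
  have key : 𝓕 uT = hh.toLp _ := by
    refine ext_inner_left ℂ fun v => ?_
    obtain ⟨φ, rfl⟩ := (Lp.fourierTransformₗᵢ V E).surjective v
    change inner ℂ (𝓕 φ) (𝓕 uT) = inner ℂ (𝓕 φ) (hh.toLp _)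
    refine dense_integrable.induction (P := fun φ : Lp E 2 (volume : Measure V) =>
      inner ℂ (𝓕 φ) (𝓕 uT) = inner ℂ (𝓕 φ) (hh.toLp _)) ?_ ?_ φ
    · intro φ hφ
      have m1 : MemLp (fun y => φ (L y + t)) 2 volume := memLp_comp L
        (g := fun y => φ (y + t)) ((Lp.memLp φ).comp_measurePreserving
          (measurePreserving_add_right volume t))
      have m2 : Integrable (fun y => φ (L y + t)) volume := by
        have hφ1 := memLp_one_iff_integrable.2 hφ
        rw [← memLp_one_iff_integrable]
        exact memLp_comp L (g := fun y => φ (y + t)) (hφ1.comp_measurePreserving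
          (measurePreserving_add_right volume t))
      set φ' := m1.toLp _ with hφ'
      have e1 : φ' =ᵐ[volume] _ := m1.coeFn_toLp
      have e2 := (fourier_ae_eq φ' (m2.congr e1.symm))
      have A1 : inner ℂ (𝓕 φ) (𝓕 uT) = d • inner ℂ (𝓕 φ') (𝓕 u) := by
        rw [Lp.inner_fourier_eq, Lp.inner_fourier_eq, L2.inner_def, L2.inner_def]
        have B1 : ∫ x, inner ℂ (φ x) (uT x) = ∫ x, inner ℂ (φ (x + t)) (u (L.symm x)) := by
          rw [← integral_add_right_eq_self (fun x => inner ℂ (φ x) (uT x)) t]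
          refine integral_congr_ae ?_
          filter_upwards [(measurePreserving_add_right volume t).quasiMeasurePreserving.ae hu]
            with x hx
          simp [hx]
        have B2 : ∫ x, inner ℂ (φ' x) (u x) = ∫ x, inner ℂ (φ (L x + t)) (u x) := by
          refine integral_congr_ae ?_
          filter_upwards [e1] with x hx
          rw [hx]
        rw [B1, B2]
        have B3 := integral_comp L (fun x => inner ℂ (φ (x + t)) (u (L.symm x)))
        simp only [ContinuousLinearEquiv.symm_apply_apply] at B3
        rw [B3, smul_smul, mul_inv_cancel₀ hd0, one_smul]
      rw [A1, L2.inner_def, L2.inner_def]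
      have B4 := integral_comp L' (fun x => inner ℂ (𝓕 φ' x) (𝓕 u x))
      rw [hdet, eq_inv_smul_iff₀ hd0] at B4
      rw [← B4, ← integral_smul, ← integral_smul]
      refine integral_congr_ae ?_
      filter_upwards [hh.coeFn_toLp, (quasiMeasurePreserving L').ae e2, fourier_ae_eq φ hφ] with w h1 h2 h3
      rw [h1, h2, h3, Real.fourier_congr_ae e1, fourier_comp_affine L L' hadj, ← hd]
      simp only [Circle.smul_def, inner_smul_left, inner_smul_right,
        RCLike.real_smul_eq_coe_smul (K := ℂ),
        smul_eq_mul, AddChar.map_neg_eq_inv, Circle.coe_inv_eq_conj]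
      have : (d : ℂ) ≠ 0 := by exact_mod_cast hd0
      simp only [Complex.coe_algebraMap, map_inv₀, Complex.conj_ofReal]
      field_simp
    · exact isClosed_eq (continuous_fourier.inner continuous_const)
        (continuous_fourier.inner continuous_const)
  rw [key]
  exact hh.coeFn_toLp

/-- A conjugate-linear map intertwines the Fourier transform with its reflection. -/
theorem fourier_conj (K : E →L⋆[ℂ] E) (u : Lp E 2 (volume : Measure V)) :
    (𝓕 (K.compLpL 2 volume u) : Lp E 2 (volume : Measure V)) =ᵐ[volume] fun w =>
      K ((𝓕 u : Lp E 2 (volume : Measure V)) (-w)) := by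
  let N := Lp.compMeasurePreservingₗᵢ (E := E) (p := 2) ℂ (Neg.neg : V → V)
    (Measure.measurePreserving_neg volume)
  have hN : ∀ v, N v =ᵐ[volume] fun w => v (-w) := fun v =>
    Lp.coeFn_compMeasurePreserving v (Measure.measurePreserving_neg volume)
  have hKN : ∀ v, K.compLpL 2 volume (N v) =ᵐ[volume] fun w => K (v (-w)) := fun v => by
    filter_upwards [K.coeFn_compLpL (N v), hN v] with w h1 h2
    rw [h1, h2]
  suffices 𝓕 (K.compLpL 2 volume u) = K.compLpL 2 volume (N (𝓕 u)) by
    rw [this]; exact hKN _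
  -- Both sides are continuous in `u`, so it is enough to treat `u` in `L¹ ∩ L²`.
  refine dense_integrable.induction (P := fun u : Lp E 2 (volume : Measure V) =>
    𝓕 (K.compLpL 2 volume u) = K.compLpL 2 volume (N (𝓕 u))) ?_ ?_ u
  · intro u hu
    have hA := K.coeFn_compLpL u
    have hAi : Integrable (K.compLpL 2 volume u) := (K.integrable_comp hu).congr hA.symm
    apply Lp.ext
    refine (fourier_ae_eq _ hAi).trans ?_
    filter_upwards [hKN (𝓕 u), (Measure.measurePreserving_neg
      (volume : Measure V)).quasiMeasurePreserving.ae (fourier_ae_eq u hu)] with w h1 h2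
    rw [h1, h2, Real.fourier_congr_ae hA]
    -- Bochner integrals commute with real-linear maps, so `K` is viewed over `ℝ`.
    let Kr : E →L[ℝ] E :=
      { toFun := K
        map_add' := map_add K
        map_smul' := fun r x => by
          rw [RCLike.real_smul_eq_coe_smul (K := ℂ), RCLike.real_smul_eq_coe_smul (K := ℂ),
            map_smulₛₗ]
          simp
        cont := K.continuous }
    rw [Real.fourier_eq, Real.fourier_eq]
    change _ = Kr _
    rw [← Kr.integral_comp_comm]
    · congr 1; ext v
      change _ = K _
      simp [Circle.smul_def, ← Circle.coe_inv_eq_conj, ← AddChar.map_neg_eq_inv]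
    · exact (Real.fourierIntegral_convergent_iff (-w)).2 hu
  · exact isClosed_eq (continuous_fourier.comp (K.compLpL 2 volume).continuous)
      ((K.compLpL 2 volume).continuous.comp (N.continuous.comp continuous_fourier))

end

end L2Fourier

namespace QuatShearlet

open MeasureTheory FourierTransform Filter Topology
open scoped Quaternion ENNReal RealInnerProductSpace

noncomputable section

/-! ### The complexified quaternions -/

/-- The complexified quaternions `ℍ ⊗ ℂ`, as four complex coordinates along `1, i, j, k`. -/
abbrev E4 : Type := EuclideanSpace ℂ (Fin 4)

/-- The inclusion of the quaternions into their complexification. -/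
def complexify : ℍ[ℝ] →L[ℝ] E4 :=
  LinearMap.toContinuousLinearMap
    { toFun := fun q => !₂[(q.re : ℂ), (q.imI : ℂ), (q.imJ : ℂ), (q.imK : ℂ)]
      map_add' := fun p q => by ext k; fin_cases k <;> simp
      map_smul' := fun r q => by ext k; fin_cases k <;> simp }

theorem complexify_apply (q : ℍ[ℝ]) :
    complexify q = !₂[(q.re : ℂ), (q.imI : ℂ), (q.imJ : ℂ), (q.imK : ℂ)] := rfl

theorem norm_sq_quaternion (q : ℍ[ℝ]) :
    ‖q‖ ^ 2 = q.re ^ 2 + q.imI ^ 2 + q.imJ ^ 2 + q.imK ^ 2 := by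
  rw [sq ‖q‖, ← Quaternion.normSq_eq_norm_mul_self, Quaternion.normSq_def']

theorem norm_sq_E4 (u : E4) :
    ‖u‖ ^ 2 = (u 0).re ^ 2 + (u 0).im ^ 2 + ((u 1).re ^ 2 + (u 1).im ^ 2) +
      ((u 2).re ^ 2 + (u 2).im ^ 2) + ((u 3).re ^ 2 + (u 3).im ^ 2) := by
  rw [EuclideanSpace.norm_sq_eq, Fin.sum_univ_four]
  simp only [Complex.sq_norm, Complex.normSq_apply]
  ring

theorem norm_complexify (q : ℍ[ℝ]) : ‖complexify q‖ = ‖q‖ := by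
  rw [← sq_eq_sq₀ (norm_nonneg _) (norm_nonneg _), norm_sq_E4, norm_sq_quaternion]
  simp [complexify_apply]

/-- Left multiplication by `star (e m)` on `ℍ ⊗ ℂ`, where `e` is the basis `1, i, j, k`. -/
def leftMulStar (m : Fin 4) : E4 →L[ℂ] E4 :=
  LinearMap.toContinuousLinearMap
    { toFun := fun x => (![!₂[x 0, x 1, x 2, x 3], !₂[x 1, -x 0, x 3, -x 2],
        !₂[x 2, -x 3, -x 0, x 1], !₂[x 3, x 2, -x 1, -x 0]] : Fin 4 → E4) m
      map_add' := fun p q => by ext k; fin_cases m <;> fin_cases k <;> simp <;> ring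
      map_smul' := fun r q => by ext k; fin_cases m <;> fin_cases k <;> simp }

theorem leftMulStar_apply (m : Fin 4) (x : E4) :
    leftMulStar m x = (![!₂[x 0, x 1, x 2, x 3], !₂[x 1, -x 0, x 3, -x 2],
        !₂[x 2, -x 3, -x 0, x 1], !₂[x 3, x 2, -x 1, -x 0]] : Fin 4 → E4) m := rfl

/-- The product `u * star v` in `ℍ ⊗ ℂ`, where `star` is the tensor product of the quaternionic
and the complex conjugation. -/
def mulStar (u v : E4) : E4 := WithLp.toLp 2 fun m => inner ℂ v (leftMulStar m u)

theorem mulStar_apply (u v : E4) (m : Fin 4) : mulStar u v m = inner ℂ v (leftMulStar m u) := rfl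

theorem complexify_mul_star (p q : ℍ[ℝ]) :
    complexify (p * star q) = mulStar (complexify p) (complexify q) := by
  ext m
  rw [mulStar_apply, PiLp.inner_apply, Fin.sum_univ_four, leftMulStar_apply]
  fin_cases m <;> simp [complexify_apply] <;> ring

/-- Complex conjugation on `ℍ ⊗ ℂ`. -/
def conjE : E4 →L⋆[ℂ] E4 where
  toFun x := WithLp.toLp 2 fun k => (starRingEnd ℂ) (x k)
  map_add' x y := by ext k; simp
  map_smul' c x := by ext k; simp
  cont := by
    refine (PiLp.continuous_toLp 2 _).comp ?_
    exact continuous_pi fun k => Complex.continuous_conj.comp (by fun_prop)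

theorem conjE_apply (x : E4) (k : Fin 4) : conjE x k = (starRingEnd ℂ) (x k) := rfl

theorem conjE_complexify (q : ℍ[ℝ]) : conjE (complexify q) = complexify q := by
  ext k; rw [conjE_apply, complexify_apply]; fin_cases k <;> simp

/-- The norm of `ℍ ⊗ ℂ` is not multiplicative, but it becomes so after averaging over complex
conjugation of one factor. -/
theorem norm_mulStar_add_conj (u v : E4) :
    ‖mulStar u v‖ ^ 2 + ‖mulStar u (conjE v)‖ ^ 2 = 2 * (‖u‖ ^ 2 * ‖v‖ ^ 2) := by
  rw [norm_sq_E4, norm_sq_E4, norm_sq_E4 u, norm_sq_E4 v]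
  simp only [mulStar_apply, PiLp.inner_apply, Fin.sum_univ_four, leftMulStar_apply, conjE_apply]
  simp
  ring

theorem norm_mulStar_le (u v : E4) : ‖mulStar u v‖ ^ 2 ≤ 2 * (‖u‖ ^ 2 * ‖v‖ ^ 2) := by
  rw [← norm_mulStar_add_conj]; nlinarith [sq_nonneg ‖mulStar u (conjE v)‖]

theorem mulStar_smul_right (c : ℂ) (u v : E4) :
    mulStar u (c • v) = (starRingEnd ℂ) c • mulStar u v := by
  ext m; simp [mulStar_apply, mul_comm]

theorem continuous_mulStar : Continuous fun p : E4 × E4 => mulStar p.1 p.2 := by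
  refine (PiLp.continuous_toLp 2 _).comp (continuous_pi fun m => ?_)
  exact continuous_snd.inner ((leftMulStar m).continuous.comp continuous_fst)

theorem continuous_mulStar_right (u : E4) : Continuous (mulStar u) := by
  refine (PiLp.continuous_toLp 2 _).comp (continuous_pi fun m => ?_)
  exact continuous_id.inner continuous_const

/-! ### The two-sided kernel -/

@[simp] theorem qI_re : qI.re = 0 := rfl
@[simp] theorem qI_imI : qI.imI = 1 := rfl
@[simp] theorem qI_imJ : qI.imJ = 0 := rfl
@[simp] theorem qI_imK : qI.imK = 0 := rfl
@[simp] theorem qJ_re : qJ.re = 0 := rfl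
@[simp] theorem qJ_imI : qJ.imI = 0 := rfl
@[simp] theorem qJ_imJ : qJ.imJ = 1 := rfl
@[simp] theorem qJ_imK : qJ.imK = 0 := rfl

/-- The real part of an element of `ℍ ⊗ ℂ`. -/
def reQ (c : E4) : ℍ[ℝ] := ⟨(c 0).re, (c 1).re, (c 2).re, (c 3).re⟩

/-- The imaginary part of an element of `ℍ ⊗ ℂ`. -/
def imQ (c : E4) : ℍ[ℝ] := ⟨(c 0).im, (c 1).im, (c 2).im, (c 3).im⟩

@[simp] theorem reQ_re (c : E4) : (reQ c).re = (c 0).re := rfl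
@[simp] theorem reQ_imI (c : E4) : (reQ c).imI = (c 1).re := rfl
@[simp] theorem reQ_imJ (c : E4) : (reQ c).imJ = (c 2).re := rfl
@[simp] theorem reQ_imK (c : E4) : (reQ c).imK = (c 3).re := rfl
@[simp] theorem imQ_re (c : E4) : (imQ c).re = (c 0).im := rfl
@[simp] theorem imQ_imI (c : E4) : (imQ c).imI = (c 1).im := rfl
@[simp] theorem imQ_imJ (c : E4) : (imQ c).imJ = (c 2).im := rfl
@[simp] theorem imQ_imK (c : E4) : (imQ c).imK = (c 3).im := rfl

/-- The `ℝ`-linear map `ℍ ⊗ ℂ → ℍ` which projects real and imaginary part to the eigenspace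
`i q j = -ε q` and turns multiplication by the complex unit into right multiplication
by `j`; here `ε = 1` or `ε = -1`. -/
def eigenProj (ε : ℝ) : E4 →L[ℝ] ℍ[ℝ] :=
  LinearMap.toContinuousLinearMap
    { toFun := fun c => (1 / 2 : ℝ) • (reQ c - ε • (qI * reQ c * qJ)) +
        (1 / 2 : ℝ) • (imQ c - ε • (qI * imQ c * qJ)) * qJ
      map_add' := fun p q => by ext <;> simp <;> ring
      map_smul' := fun r q => by ext <;> simp <;> ring }

theorem eigenProj_apply (ε : ℝ) (c : E4) :
    eigenProj ε c = (1 / 2 : ℝ) • (reQ c - ε • (qI * reQ c * qJ)) +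
        (1 / 2 : ℝ) • (imQ c - ε • (qI * imQ c * qJ)) * qJ := rfl

/-- The two eigenspaces of `q ↦ i q j` are orthogonal. -/
theorem norm_eigenProj_add (c d : E4) :
    ‖eigenProj 1 c + eigenProj (-1) d‖ ^ 2 = ‖eigenProj 1 c‖ ^ 2 + ‖eigenProj (-1) d‖ ^ 2 := by
  simp only [norm_sq_quaternion, eigenProj_apply]
  simp
  ring

/-- The two projections together preserve the norm, up to averaging over complex conjugation. -/
theorem norm_eigenProj_conj (c : E4) :
    ‖eigenProj 1 c‖ ^ 2 + ‖eigenProj (-1) c‖ ^ 2 +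
      (‖eigenProj 1 (conjE c)‖ ^ 2 + ‖eigenProj (-1) (conjE c)‖ ^ 2) = 2 * ‖c‖ ^ 2 := by
  simp only [norm_sq_quaternion, norm_sq_E4, eigenProj_apply]
  simp [conjE_apply]
  ring

theorem exp_smul_of_sq {q : ℍ[ℝ]} (h0 : q.re = 0) (h1 : ‖q‖ = 1) (r : ℝ) :
    NormedSpace.exp (r • q) = (Real.cos r : ℍ[ℝ]) + Real.sin r • q := by
  rw [Quaternion.exp_of_re_eq_zero _ (by simp [h0]), norm_smul, h1, mul_one, Real.norm_eq_abs,
    Real.cos_abs, smul_smul]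
  congr 2
  rcases eq_or_ne r 0 with rfl | hr
  · simp
  · rcases abs_cases r with ⟨h, -⟩ | ⟨h, -⟩ <;> rw [h]
    · field_simp
    · rw [Real.sin_neg]; field_simp

/-- The two-sided kernel `e^{-iα} q e^{-jβ}` acts on the two eigenspaces of `q ↦ i q j` through
the characters `e^{-i(α+β)}` and `e^{-i(β-α)}`. -/
theorem exp_mul_mul_exp (α β : ℝ) (q : ℍ[ℝ]) :
    NormedSpace.exp ((-α) • qI) * q * NormedSpace.exp ((-β) • qJ) =
      eigenProj 1 (Complex.exp (((-(α + β) : ℝ) : ℂ) * Complex.I) • complexify q) +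
      eigenProj (-1) (Complex.exp (((-(β - α) : ℝ) : ℂ) * Complex.I) • complexify q) := by
  have hI : ‖qI‖ = 1 := by
    rw [← sq_eq_sq₀ (norm_nonneg _) zero_le_one, norm_sq_quaternion]; simp
  have hJ : ‖qJ‖ = 1 := by
    rw [← sq_eq_sq₀ (norm_nonneg _) zero_le_one, norm_sq_quaternion]; simp
  rw [exp_smul_of_sq (by simp) hI, exp_smul_of_sq (by simp) hJ, eigenProj_apply,
    eigenProj_apply]
  have e : ∀ x y : ℝ, (Complex.exp ((x : ℂ) * Complex.I) * (y : ℂ)).re = Real.cos x * y ∧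
      (Complex.exp ((x : ℂ) * Complex.I) * (y : ℂ)).im = Real.sin x * y := by
    intro x y
    rw [Complex.re_mul_ofReal, Complex.im_mul_ofReal, Complex.exp_ofReal_mul_I_re,
      Complex.exp_ofReal_mul_I_im]
    exact ⟨rfl, rfl⟩
  ext <;> simp [complexify_apply, -Complex.ofReal_neg, -Complex.ofReal_sub,
    -Complex.ofReal_add, -Complex.mul_re, -Complex.mul_im, e, Real.cos_add, Real.sin_add,
    Real.cos_sub, Real.sin_sub, -neg_add_rev, -neg_sub] <;> ring

/-! ### The two-sided transform through the ordinary one -/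

variable {n : ℕ}

/-- The `ℍ ⊗ ℂ`-valued `L²` function with the same values as the quaternion-valued `f`. -/
def complexifyL2 : L2H n →L[ℝ] Lp E4 2 (volume : Measure (Space n)) :=
  complexify.compLpL 2 volume

theorem coeFn_complexifyL2 (f : L2H n) :
    complexifyL2 f =ᵐ[volume] fun x => complexify (f x) :=
  complexify.coeFn_compLpL f

/-- The ordinary `L²` Fourier transform of a quaternion-valued function, with values in
`ℍ ⊗ ℂ`. -/
def hat (f : L2H n) : Lp E4 2 (volume : Measure (Space n)) := 𝓕 (complexifyL2 f)

theorem continuous_hat : Continuous (hat : L2H n → _) :=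
  continuous_fourier.comp complexifyL2.continuous

theorem norm_complexifyL2 (f : L2H n) : ‖complexifyL2 f‖ = ‖f‖ := by
  rw [Lp.norm_def, Lp.norm_def]
  congr 1
  refine eLpNorm_congr_norm_ae ?_
  filter_upwards [coeFn_complexifyL2 f] with x hx
  rw [hx, norm_complexify]

theorem norm_hat (f : L2H n) : ‖hat f‖ = ‖f‖ := by
  rw [hat, Lp.norm_fourier_eq, norm_complexifyL2]

theorem integrable_complexifyL2 {f : L2H n} (hf : Integrable f volume) :
    Integrable (complexifyL2 f) volume :=
  (complexify.integrable_comp hf).congr (coeFn_complexifyL2 f).symm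

/-- The Fourier transform of a function without imaginary part is invariant under reflection
followed by complex conjugation. -/
theorem hat_neg (f : L2H n) : ∀ᵐ w, hat f w = conjE (hat f (-w)) := by
  have h : conjE.compLpL 2 volume (complexifyL2 f) = complexifyL2 f := by
    apply Lp.ext
    filter_upwards [conjE.coeFn_compLpL (complexifyL2 f), coeFn_complexifyL2 f] with x h1 h2
    rw [h1, h2, conjE_complexify]
  have h2 := L2Fourier.fourier_conj conjE (complexifyL2 f)
  rw [h] at h2
  exact h2

/-- The partial reflection `(u, v) ↦ (-u, v)` of `ℝ^n × ℝ^n`. -/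
def flipFst (n : ℕ) : Space n ≃ₗᵢ[ℝ] Space n :=
  LinearIsometryEquiv.piLpCongrRight 2 fun k : Fin (2 * n) =>
    if (k : ℕ) < n then LinearIsometryEquiv.neg ℝ else LinearIsometryEquiv.refl ℝ ℝ

theorem flipFst_apply (w : Space n) (k : Fin (2 * n)) :
    flipFst n w k = if (k : ℕ) < n then -w k else w k := by
  simp only [flipFst, LinearIsometryEquiv.piLpCongrRight_apply]
  split_ifs <;> simp

theorem inner_eq_dot (w z : Space n) : ⟪z, w⟫ = dotFst w z + dotSnd w z := by
  rw [PiLp.inner_apply, dotFst, dotSnd, ← Finset.sum_filter_add_sum_filter_not _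
    (fun k : Fin (2 * n) => (k : ℕ) < n)]
  simp only [not_lt]
  congr 1

theorem inner_flipFst (w z : Space n) : ⟪z, flipFst n w⟫ = dotSnd w z - dotFst w z := by
  rw [inner_eq_dot]
  have h1 : dotFst (flipFst n w) z = - dotFst w z := by
    rw [dotFst, dotFst, ← Finset.sum_neg_distrib]
    refine Finset.sum_congr rfl fun k hk => ?_
    rw [flipFst_apply, if_pos (Finset.mem_filter.1 hk).2, neg_mul]
  have h2 : dotSnd (flipFst n w) z = dotSnd w z := by
    rw [dotSnd, dotSnd]
    refine Finset.sum_congr rfl fun k hk => ?_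
    rw [flipFst_apply, if_neg (not_lt.2 (Finset.mem_filter.1 hk).2)]
  rw [h1, h2]; ring

/-- The two-sided transform expressed through the ordinary Fourier integral. -/
theorem qftIntegral_eq {f : Space n → ℍ[ℝ]} (hf : Integrable f volume) (w : Space n) :
    qftIntegral f w = eigenProj 1 (𝓕 (fun x => complexify (f x)) w) +
      eigenProj (-1) (𝓕 (fun x => complexify (f x)) (flipFst n w)) := by
  have hi : ∀ v, Integrable (fun x : Space n => Real.fourierChar (-⟪x, v⟫) • complexify (f x))
      volume := fun v => (Real.fourierIntegral_convergent_iff v).2 (complexify.integrable_comp hf)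
  rw [qftIntegral, Real.fourier_eq, Real.fourier_eq, ← (eigenProj 1).integral_comp_comm (hi _),
    ← (eigenProj (-1)).integral_comp_comm (hi _),
    ← integral_add ((eigenProj 1).integrable_comp (hi _))
      ((eigenProj (-1)).integrable_comp (hi _))]
  congr 1
  ext1 z
  rw [exp_mul_mul_exp, inner_eq_dot, inner_flipFst]
  simp only [Circle.smul_def, Real.fourierChar_apply]
  congr 6 <;> ring

/-- The two-sided transform on `L²` written through `hat`: each eigenspace component of `hat f` is
read off at `w` or at the partial reflection of `w`. -/
def qftMap (f : L2H n) : L2H n :=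
  (eigenProj 1).compLpL 2 volume (hat f) +
    (eigenProj (-1)).compLpL 2 volume
      (Lp.compMeasurePreserving (flipFst n) (flipFst n).measurePreserving (hat f))

theorem continuous_qftMap : Continuous (qftMap : L2H n → L2H n) := by
  refine Continuous.add ?_ ?_
  · exact ((eigenProj 1).compLpL 2 volume).continuous.comp continuous_hat
  · refine ((eigenProj (-1)).compLpL 2 volume).continuous.comp ?_
    exact (Lp.compMeasurePreservingₗᵢ (E := E4) (p := 2) ℝ (flipFst n)
      (flipFst n).measurePreserving).continuous.comp continuous_hat

theorem qftMap_ae (f : L2H n) : ∀ᵐ w, qftMap f w =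
    eigenProj 1 (hat f w) + eigenProj (-1) (hat f (flipFst n w)) := by
  filter_upwards [Lp.coeFn_add ((eigenProj 1).compLpL 2 volume (hat f))
    ((eigenProj (-1)).compLpL 2 volume
      (Lp.compMeasurePreserving (flipFst n) (flipFst n).measurePreserving (hat f))),
    (eigenProj 1).coeFn_compLpL (hat f), (eigenProj (-1)).coeFn_compLpL
      (Lp.compMeasurePreserving (flipFst n) (flipFst n).measurePreserving (hat f)),
    Lp.coeFn_compMeasurePreserving (hat f) (flipFst n).measurePreserving] with w h1 h2 h3 h4
  rw [qftMap, h1, Pi.add_apply, h2, h3, h4, Function.comp_apply]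

/-- On `L¹ ∩ L²` the integral transform is square integrable, so `qftL1L2` takes its first
branch there. -/
theorem qftL1L2_eq {f : L2H n} (hf : Integrable f volume) : qftL1L2 f = qftMap f := by
  have hF : ∀ w, 𝓕 (complexifyL2 f : Space n → E4) w = 𝓕 (fun x => complexify (f x)) w :=
    fun w => Real.fourier_congr_ae (coeFn_complexifyL2 f) w
  have h := L2Fourier.fourier_ae_eq _ (integrable_complexifyL2 hf)
  have key : qftMap f =ᵐ[volume] qftIntegral f := by
    filter_upwards [qftMap_ae f, h,
      (flipFst n).measurePreserving.quasiMeasurePreserving.ae h] with w h1 h2 h3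
    rw [h1, qftIntegral_eq hf, ← hF, ← hF, ← h2, ← h3, hat]
  have hm : MemLp (qftIntegral f) 2 (volume : Measure (Space n)) := (Lp.memLp _).ae_eq key
  rw [qftL1L2, dif_pos hm]
  apply Lp.ext
  exact hm.coeFn_toLp.trans key.symm

/-- `qftMap` is continuous and agrees with the integral transform on the dense set `L¹ ∩ L²`, so it
is the extension by continuity. -/
theorem qft_eq (f : L2H n) : qft f = qftMap f := by
  refine extendFrom_eq (L2Fourier.dense_integrable f) ?_
  refine (continuous_qftMap.continuousWithinAt (s := {f : L2H n | Integrable f volume})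
    (x := f)).tendsto.congr' ?_
  filter_upwards [self_mem_nhdsWithin] with g hg
  exact (qftL1L2_eq hg).symm

theorem enorm_sq {A : Type*} [NormedAddCommGroup A] (a : A) :
    ‖a‖ₑ ^ 2 = ENNReal.ofReal (‖a‖ ^ 2) := by
  rw [← ofReal_norm, ENNReal.ofReal_pow (norm_nonneg _)]

/-- A function of `hat f` may be averaged over complex conjugation when integrated against an
even weight, because `hat f (-w)` is the conjugate of `hat f w`. -/
theorem lintegral_symmetrize (f : L2H n) (P : E4 → ℝ≥0∞) (hP : Measurable P) (k : ℝ≥0∞)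
    (hk : k ≠ ∞) (hPc : ∀ c, P c + P (conjE c) = 2 * (k * ‖c‖ₑ ^ 2))
    (W : Space n → ℝ≥0∞) (hW : Measurable W) (hneg : ∀ w, W (-w) = W w) :
    ∫⁻ w, P (hat f w) * W w = k * ∫⁻ w, ‖hat f w‖ₑ ^ 2 * W w := by
  have hmP : AEMeasurable (fun w => P (hat f w) * W w) volume :=
    ((hP.comp (Lp.stronglyMeasurable (hat f)).measurable).mul hW).aemeasurable
  have h2 : ∫⁻ w, P (hat f w) * W w = ∫⁻ w, P (conjE (hat f w)) * W w := by
    have e3 := (Measure.measurePreserving_neg (volume : Measure (Space n))).lintegral_comp_emb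
      (MeasurableEquiv.neg (Space n)).measurableEmbedding (fun w => P (conjE (hat f w)) * W w)
    rw [← e3]
    refine lintegral_congr_ae ?_
    filter_upwards [hat_neg f] with w hw
    rw [hneg, ← hw]
  have h3 : 2 * ∫⁻ w, P (hat f w) * W w = 2 * (k * ∫⁻ w, ‖hat f w‖ₑ ^ 2 * W w) := by
    rw [two_mul]
    nth_rw 2 [h2]
    rw [← lintegral_add_left' hmP, ← lintegral_const_mul' _ _ hk,
      ← lintegral_const_mul' _ _ (by simp)]
    refine lintegral_congr fun w => ?_
    rw [← add_mul, hPc, mul_assoc, mul_assoc]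
  exact (ENNReal.mul_right_inj (by simp) (by simp)).1 h3

/-- Weighted Plancherel formula for the two-sided transform, for weights which are invariant
under `w ↦ -w` and `(u, v) ↦ (-u, v)`. -/
theorem lintegral_qft (f : L2H n) (W : Space n → ℝ≥0∞) (hW : Measurable W)
    (hneg : ∀ w, W (-w) = W w) (hflip : ∀ w, W (flipFst n w) = W w) :
    ∫⁻ w, ‖qft f w‖ₑ ^ 2 * W w = ∫⁻ w, ‖hat f w‖ₑ ^ 2 * W w := by
  have hm : ∀ ε, AEMeasurable (fun w => ‖eigenProj ε (hat f w)‖ₑ ^ 2 * W w) volume := fun ε =>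
    ((((eigenProj ε).continuous.comp_stronglyMeasurable
      (Lp.stronglyMeasurable (hat f))).enorm.pow_const 2).mul hW).aemeasurable
  have h1 : ∫⁻ w, ‖qft f w‖ₑ ^ 2 * W w =
      ∫⁻ w, (‖eigenProj 1 (hat f w)‖ₑ ^ 2 + ‖eigenProj (-1) (hat f w)‖ₑ ^ 2) * W w := by
    have e1 : ∫⁻ w, ‖qft f w‖ₑ ^ 2 * W w = ∫⁻ w, (‖eigenProj 1 (hat f w)‖ₑ ^ 2 * W w +
        ‖eigenProj (-1) (hat f (flipFst n w))‖ₑ ^ 2 * W (flipFst n w)) := by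
      refine lintegral_congr_ae ?_
      filter_upwards [qftMap_ae f] with w hw
      rw [qft_eq, hw, hflip, ← add_mul]
      congr 1
      simp only [enorm_sq]
      rw [norm_eigenProj_add, ENNReal.ofReal_add (sq_nonneg _) (sq_nonneg _)]
    have e2 : ∫⁻ w, ‖eigenProj (-1) (hat f (flipFst n w))‖ₑ ^ 2 * W (flipFst n w) =
        ∫⁻ w, ‖eigenProj (-1) (hat f w)‖ₑ ^ 2 * W w :=
      (flipFst n).measurePreserving.lintegral_comp_emb
        (flipFst n).toHomeomorph.measurableEmbedding
        (fun w => ‖eigenProj (-1) (hat f w)‖ₑ ^ 2 * W w)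
    rw [e1, lintegral_add_left' (hm 1), e2, ← lintegral_add_left' (hm 1)]
    simp_rw [add_mul]
  rw [h1]
  have h4 := lintegral_symmetrize f
    (fun c => ‖eigenProj 1 c‖ₑ ^ 2 + ‖eigenProj (-1) c‖ₑ ^ 2)
    (((eigenProj 1).continuous.enorm.measurable.pow_const 2).add
      ((eigenProj (-1)).continuous.enorm.measurable.pow_const 2))
    1 (by simp) (fun c => ?_) W hW hneg
  · rw [h4, one_mul]
  · simp only [enorm_sq]
    rw [one_mul, ← ENNReal.ofReal_add (by positivity) (by positivity),
      ← ENNReal.ofReal_add (by positivity) (by positivity),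
      ← ENNReal.ofReal_add (by positivity) (by positivity), norm_eigenProj_conj,
      ENNReal.ofReal_mul (by norm_num), ENNReal.ofReal_ofNat]

/-- Quaternionic conjugation on `ℍ ⊗ ℂ`, as a `ℂ`-linear map. -/
def starE : E4 →L[ℂ] E4 :=
  LinearMap.toContinuousLinearMap
    { toFun := fun x => !₂[x 0, -x 1, -x 2, -x 3]
      map_add' := fun p q => by ext k; fin_cases k <;> simp <;> ring
      map_smul' := fun r q => by ext k; fin_cases k <;> simp }

theorem starE_apply (x : E4) : starE x = !₂[x 0, -x 1, -x 2, -x 3] := rfl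

theorem norm_starE (x : E4) : ‖starE x‖ = ‖x‖ := by
  rw [← sq_eq_sq₀ (norm_nonneg _) (norm_nonneg _), norm_sq_E4, norm_sq_E4]
  simp [starE_apply]

theorem complexify_star (q : ℍ[ℝ]) : complexify (star q) = starE (complexify q) := by
  ext k; rw [starE_apply, complexify_apply, complexify_apply]; fin_cases k <;> simp

theorem norm_hat_reflConj (ψ : L2H n) : ∀ᵐ w, ‖hat (reflConj ψ) w‖ = ‖hat ψ (-w)‖ := by
  have hm : MemLp (fun x => complexifyL2 ψ (-x)) 2 (volume : Measure (Space n)) :=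
    (Lp.memLp _).comp_measurePreserving (Measure.measurePreserving_neg volume)
  have hN : Measure.QuasiMeasurePreserving (fun x : Space n => -x) volume volume :=
    (Measure.measurePreserving_neg (volume : Measure (Space n))).quasiMeasurePreserving
  have h1 : complexifyL2 (reflConj ψ) = starE.compLpL 2 volume (hm.toLp _) := by
    apply Lp.ext
    filter_upwards [coeFn_complexifyL2 (reflConj ψ), starE.coeFn_compLpL (hm.toLp _),
      hm.coeFn_toLp, hN.ae (coeFn_complexifyL2 ψ), (memLp_reflConj ψ).coeFn_toLp]
      with x e1 e2 e3 e4 e5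
    rw [e1, e2, e3, e4, reflConj, e5, complexify_star]
  have hdet : |LinearMap.det ((ContinuousLinearEquiv.neg ℝ : Space n ≃L[ℝ] Space n) :
      Space n →ₗ[ℝ] Space n)| = 1 := by
    have : ((ContinuousLinearEquiv.neg ℝ : Space n ≃L[ℝ] Space n) : Space n →ₗ[ℝ] Space n) =
        (-1 : ℝ) • LinearMap.id := by ext x; simp
    rw [this, LinearMap.det_smul]; simp
  have h2 := L2Fourier.fourier_affine (ContinuousLinearEquiv.neg ℝ : Space n ≃L[ℝ] Space n)
    (ContinuousLinearEquiv.neg ℝ) (fun y w => by simp) rfl 0 (complexifyL2 ψ) (hm.toLp _)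
    (by simpa using hm.coeFn_toLp)
  rw [hat, h1, L2Fourier.fourier_compLpL]
  filter_upwards [starE.coeFn_compLpL (𝓕 (hm.toLp _)), h2] with w e1 e2
  rw [e1, e2, norm_starE, hdet]
  simp [hat]

/-! ### The admissibility constant -/

variable [NeZero n]

/-- The weight `|w₁|^{-2n}` of the admissibility condition, infinite on the hyperplane `w₁ = 0`. -/
def weight (w : Space n) : ℝ≥0∞ := (‖w 0‖ₑ ^ (2 * n))⁻¹

theorem measurable_weight : Measurable (weight : Space n → ℝ≥0∞) := by
  unfold weight; fun_prop

theorem weight_neg (w : Space n) : weight (-w) = weight w := by simp [weight]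

theorem weight_flipFst (w : Space n) : weight (flipFst n w) = weight w := by
  rw [weight, weight, flipFst_apply]; split_ifs <;> simp

/-- The admissibility constant through the ordinary Fourier transform of `ψ`. -/
theorem admConst_eq (ψ : L2H n) : admConst ψ = ∫⁻ w, ‖hat ψ w‖ₑ ^ 2 * weight w := by
  have h := lintegral_qft (reflConj ψ) weight measurable_weight weight_neg weight_flipFst
  rw [admConst]
  refine h.trans ?_
  have e3 := (Measure.measurePreserving_neg (volume : Measure (Space n))).lintegral_comp_emb
      (MeasurableEquiv.neg (Space n)).measurableEmbedding (fun w => ‖hat ψ w‖ₑ ^ 2 * weight w)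
  rw [← e3]
  refine lintegral_congr_ae ?_
  filter_upwards [norm_hat_reflConj ψ] with w hw
  rw [weight_neg, enorm_sq, hw, ← enorm_sq]

/-- Averaging the non-multiplicative norm over the symmetry `w ↦ -w` of `hat ψ` gives the
admissibility constant. -/
theorem lintegral_mulStar (ψ : L2H n) (u : E4) :
    ∫⁻ w, ‖mulStar u (hat ψ w)‖ₑ ^ 2 * weight w = ‖u‖ₑ ^ 2 * admConst ψ := by
  have hc := continuous_mulStar_right u
  rw [admConst_eq]
  refine lintegral_symmetrize ψ (fun c => ‖mulStar u c‖ₑ ^ 2) (hc.enorm.measurable.pow_const 2)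
    (‖u‖ₑ ^ 2) (by simp) (fun c => ?_) weight measurable_weight weight_neg
  simp only [enorm_sq]
  rw [← ENNReal.ofReal_add (by positivity) (by positivity), norm_mulStar_add_conj,
    ENNReal.ofReal_mul (by norm_num), ENNReal.ofReal_mul (by positivity), ENNReal.ofReal_ofNat]

/-! ### The shearlet group acting on frequencies -/

/-- Invertible matrices as linear automorphisms of Euclidean space. -/
def matrixEquiv {N : ℕ} (M : Matrix (Fin N) (Fin N) ℝ) (hM : IsUnit M.det) :
    EuclideanSpace ℝ (Fin N) ≃L[ℝ] EuclideanSpace ℝ (Fin N) :=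
  (LinearEquiv.ofLinearMap (Matrix.toEuclideanLin M) (Matrix.toEuclideanLin M⁻¹)
    (by ext1 x; simp [Matrix.toLpLin_apply, M.mul_nonsing_inv hM])
    (by ext1 x; simp [Matrix.toLpLin_apply, M.nonsing_inv_mul hM])).toContinuousLinearEquiv

theorem matrixEquiv_apply {N : ℕ} (M : Matrix (Fin N) (Fin N) ℝ) (hM : IsUnit M.det)
    (x : EuclideanSpace ℝ (Fin N)) : matrixEquiv M hM x = Matrix.toEuclideanLin M x := rfl

theorem matrixEquiv_symm_apply {N : ℕ} (M : Matrix (Fin N) (Fin N) ℝ) (hM : IsUnit M.det)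
    (x : EuclideanSpace ℝ (Fin N)) :
    (matrixEquiv M hM).symm x = Matrix.toEuclideanLin M⁻¹ x := rfl

theorem det_matrixEquiv {N : ℕ} (M : Matrix (Fin N) (Fin N) ℝ) (hM : IsUnit M.det) :
    LinearMap.det (matrixEquiv M hM : EuclideanSpace ℝ (Fin N) →ₗ[ℝ] EuclideanSpace ℝ (Fin N))
      = M.det := by
  have : (matrixEquiv M hM : EuclideanSpace ℝ (Fin N) →ₗ[ℝ] EuclideanSpace ℝ (Fin N)) =
    Matrix.toEuclideanLin M := rfl
  rw [this, Matrix.toEuclideanLin, Matrix.toLpLin_eq_toLin, LinearMap.det_toLin]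

theorem inner_toEuclideanLin {N : ℕ} (M : Matrix (Fin N) (Fin N) ℝ)
    (y w : EuclideanSpace ℝ (Fin N)) :
    ⟪Matrix.toEuclideanLin M y, w⟫ = ⟪y, Matrix.toEuclideanLin M.transpose w⟫ := by
  have h := Matrix.toEuclideanLin_conjTranspose_eq_adjoint M
  rw [Matrix.conjTranspose_eq_transpose_of_trivial] at h
  rw [h, LinearMap.adjoint_inner_right]

/-- The vector with first coordinate `r` and remaining coordinates `v`. -/
def consE {N m : ℕ} (h : N = m + 1) (p : ℝ × EuclideanSpace ℝ (Fin m)) :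
    EuclideanSpace ℝ (Fin N) :=
  WithLp.toLp 2 fun k => if hk : (k : ℕ) = 0 then p.1 else p.2 ⟨(k : ℕ) - 1, by omega⟩

theorem measurePreserving_consE {N m : ℕ} (h : N = m + 1) :
    MeasurePreserving (consE h : ℝ × EuclideanSpace ℝ (Fin m) → EuclideanSpace ℝ (Fin N)) := by
  subst h
  have h1 : MeasurePreserving (Prod.map id (WithLp.ofLp (p := 2)) :
      ℝ × EuclideanSpace ℝ (Fin m) → ℝ × (Fin m → ℝ)) :=
    (MeasurePreserving.id volume).prod (PiLp.volume_preserving_ofLp (Fin m))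
  have h2 := (volume_preserving_piFinSuccAbove (fun _ : Fin (m + 1) => ℝ) 0).symm
  have h3 := PiLp.volume_preserving_toLp (Fin (m + 1))
  have h4 := (h3.comp h2).comp h1
  convert h4 using 1
  ext p k
  refine Fin.cases ?_ (fun i => ?_) k
  · simp [consE, MeasurableEquiv.piFinSuccAbove]
  · simp [consE, MeasurableEquiv.piFinSuccAbove]

theorem measurable_consE {N m : ℕ} (h : N = m + 1) :
    Measurable (consE h : ℝ × EuclideanSpace ℝ (Fin m) → EuclideanSpace ℝ (Fin N)) :=
  (measurePreserving_consE h).measurable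

theorem lintegral_comp_mul_real (g : ℝ → ℝ≥0∞) {c : ℝ} (hc : c ≠ 0) :
    ∫⁻ x, g (x * c) = ENNReal.ofReal |c|⁻¹ * ∫⁻ y, g y := by
  have hu : IsUnit (c : ℝ) := hc.isUnit
  have h := L2Fourier.lintegral_comp
    (LinearEquiv.smulOfNeZero ℝ ℝ c hc).toContinuousLinearEquiv g
  have hd : LinearMap.det (((LinearEquiv.smulOfNeZero ℝ ℝ c hc).toContinuousLinearEquiv :
      ℝ ≃L[ℝ] ℝ) : ℝ →ₗ[ℝ] ℝ) = c := by
    have : (((LinearEquiv.smulOfNeZero ℝ ℝ c hc).toContinuousLinearEquiv :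
      ℝ ≃L[ℝ] ℝ) : ℝ →ₗ[ℝ] ℝ) = c • LinearMap.id := by ext; simp
    rw [this, LinearMap.det_smul]; simp
  rw [hd] at h
  rw [← h]
  refine lintegral_congr fun x => ?_
  simp [mul_comm]

theorem lintegral_comp_smul_add {m : ℕ} (g : EuclideanSpace ℝ (Fin m) → ℝ≥0∞) {c : ℝ}
    (hc : c ≠ 0) (v : EuclideanSpace ℝ (Fin m)) :
    ∫⁻ x, g (c • x + v) = ENNReal.ofReal (|c| ^ m)⁻¹ * ∫⁻ y, g y := by
  have h := L2Fourier.lintegral_comp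
    (LinearEquiv.smulOfNeZero ℝ (EuclideanSpace ℝ (Fin m)) c hc).toContinuousLinearEquiv
    (fun x => g (x + v))
  have hd : LinearMap.det (((LinearEquiv.smulOfNeZero ℝ (EuclideanSpace ℝ (Fin m)) c
      hc).toContinuousLinearEquiv : EuclideanSpace ℝ (Fin m) ≃L[ℝ] EuclideanSpace ℝ (Fin m)) :
      EuclideanSpace ℝ (Fin m) →ₗ[ℝ] EuclideanSpace ℝ (Fin m)) = c ^ m := by
    have : (((LinearEquiv.smulOfNeZero ℝ (EuclideanSpace ℝ (Fin m)) c
      hc).toContinuousLinearEquiv : EuclideanSpace ℝ (Fin m) ≃L[ℝ] EuclideanSpace ℝ (Fin m)) :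
      EuclideanSpace ℝ (Fin m) →ₗ[ℝ] EuclideanSpace ℝ (Fin m)) = c • LinearMap.id := by
        ext; simp
    rw [this, LinearMap.det_smul]; simp
  rw [hd, lintegral_add_right_eq_self, abs_pow] at h
  rw [← h]
  rfl

theorem two_mul_eq (n : ℕ) [NeZero n] : 2 * n = (2 * n - 1) + 1 := by
  have := NeZero.ne n; omega

/-- The modulus `|a|^{1/(2n)}` of the anisotropic scaling factor. -/
def rho (n : ℕ) (a : ℝ) : ℝ := |a| ^ (1 / (2 * (n : ℝ)))

theorem rho_pow (a : ℝ) : rho n a ^ (2 * n) = |a| := by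
  have hn : (n : ℝ) ≠ 0 := by exact_mod_cast NeZero.ne n
  rw [rho, ← Real.rpow_natCast, ← Real.rpow_mul (abs_nonneg a)]
  push_cast
  rw [one_div, inv_mul_cancel₀ (by positivity), Real.rpow_one]

theorem rho_pow_pred (a : ℝ) : rho n a ^ (2 * n - 1) * rho n a = |a| := by
  rw [← pow_succ, ← two_mul_eq, rho_pow]

omit [NeZero n] in
theorem rho_pos {a : ℝ} (ha : a ≠ 0) : 0 < rho n a := Real.rpow_pos_of_pos (abs_pos.2 ha) _

/-- The signed anisotropic scaling factor `sgn(a) |a|^{1/(2n)}`. -/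
def kap (n : ℕ) (a : ℝ) : ℝ := Real.sign a * rho n a

omit [NeZero n] in
theorem abs_kap {a : ℝ} (ha : a ≠ 0) : |kap n a| = rho n a := by
  rw [kap, abs_mul, abs_of_pos (rho_pos ha)]
  rcases lt_or_gt_of_ne ha with h | h
  · simp [Real.sign_of_neg h]
  · simp [Real.sign_of_pos h]

omit [NeZero n] in
theorem measurable_rho : Measurable (rho n) := by unfold rho; fun_prop

omit [NeZero n] in
theorem measurable_kap : Measurable (kap n) := by
  have : Measurable Real.sign := by
    unfold Real.sign
    exact Measurable.ite measurableSet_Iio measurable_const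
      (Measurable.ite measurableSet_Ioi measurable_const measurable_const)
  exact this.mul measurable_rho

/-- The vector without its first coordinate. -/
def tailE (w : Space n) : EuclideanSpace ℝ (Fin (2 * n - 1)) :=
  WithLp.toLp 2 fun k => w ⟨(k : ℕ) + 1, by omega⟩

/-- The action `w ↦ (S_s A_a)ᵀ w` on frequencies. -/
def freqAct (a : ℝ) (s : EuclideanSpace ℝ (Fin (2 * n - 1))) (w : Space n) : Space n :=
  consE (two_mul_eq n) (a * w 0, kap n a • (w 0 • s + tailE w))

theorem det_shearMatrix (s : EuclideanSpace ℝ (Fin (2 * n - 1))) : (shearMatrix n s).det = 1 := by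
  rw [Matrix.det_of_isUpperTriangular]
  · simp [shearMatrix]
  · intro k l hkl
    have hkl' : (l : ℕ) < k := hkl
    have h1 : k ≠ l := by rintro rfl; exact lt_irrefl _ hkl'
    simp only [shearMatrix, Matrix.of_apply, if_neg h1]
    rw [if_neg (by omega)]

theorem det_dilMatrix (a : ℝ) : (dilMatrix n a).det = a * kap n a ^ (2 * n - 1) := by
  rw [dilMatrix, Matrix.det_diagonal]
  have h := Fintype.prod_equiv (finCongr (two_mul_eq n))
    (fun k : Fin (2 * n) => if (k : ℕ) = 0 then a else Real.sign a * |a| ^ (1 / (2 * (n : ℝ))))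
    (fun k : Fin (2 * n - 1 + 1) => if (k : ℕ) = 0 then a else
      Real.sign a * |a| ^ (1 / (2 * (n : ℝ)))) (fun k => by simp)
  rw [h, Fin.prod_univ_succ]
  simp [kap, rho]

theorem abs_det (a : ℝ) (ha : a ≠ 0) (s : EuclideanSpace ℝ (Fin (2 * n - 1))) :
    |(shearMatrix n s * dilMatrix n a).det| = |a| * rho n a ^ (2 * n - 1) := by
  rw [Matrix.det_mul, det_shearMatrix, one_mul, det_dilMatrix, abs_mul, abs_pow, abs_kap ha]

theorem isUnit_det (a : ℝ) (ha : a ≠ 0) (s : EuclideanSpace ℝ (Fin (2 * n - 1))) :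
    IsUnit (shearMatrix n s * dilMatrix n a).det := by
  rw [isUnit_iff_ne_zero, ← abs_pos, abs_det a ha]
  have := rho_pos (n := n) ha
  positivity

/-- The explicit formula `freqAct` is the action of the transposed matrix. -/
theorem transpose_act (a : ℝ) (s : EuclideanSpace ℝ (Fin (2 * n - 1))) (w : Space n) :
    Matrix.toEuclideanLin (shearMatrix n s * dilMatrix n a).transpose w = freqAct a s w := by
  ext k
  rw [Matrix.toLpLin_apply]
  simp only [Matrix.transpose_mul, dilMatrix, Matrix.diagonal_transpose, ← Matrix.mulVec_mulVec,
    Matrix.mulVec_diagonal]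
  have hS : ((shearMatrix n s).transpose.mulVec w.ofLp) k =
      if hk : (k : ℕ) = 0 then w 0 else w k + w 0 * s ⟨(k : ℕ) - 1, by omega⟩ := by
    simp only [Matrix.mulVec, dotProduct, Matrix.transpose_apply, shearMatrix, Matrix.of_apply]
    by_cases hk : (k : ℕ) = 0
    · have hk0 : k = 0 := Fin.ext hk
      rw [dif_pos hk, Finset.sum_eq_single 0]
      · simp [hk0]
      · intro l _ hl
        have : (l : ℕ) ≠ 0 := fun h => hl (Fin.ext h)
        rw [if_neg (by rw [hk0]; exact hl), if_neg this, zero_mul]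
      · simp
    · have hk0 : k ≠ 0 := fun h => hk (by rw [h]; rfl)
      rw [dif_neg hk, Finset.sum_eq_add k 0 hk0]
      · simp [hk0.symm, mul_comm]
      · intro l _ hl
        have : (l : ℕ) ≠ 0 := fun h => hl.2 (Fin.ext h)
        rw [if_neg hl.1, if_neg this, zero_mul]
      · simp
      · simp
  rw [hS, freqAct, consE]
  by_cases hk : (k : ℕ) = 0
  · simp [hk]
  · have e : (⟨(k : ℕ) - 1 + 1, by omega⟩ : Fin (2 * n)) = k := Fin.ext (by simp; omega)
    simp only [hk, if_false, dif_neg, not_false_eq_true]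
    simp [kap, rho, tailE, e]
    ring_nf

/-- The orbit of a frequency with `w₁ ≠ 0` under the shearlet group covers almost every
frequency exactly once, and the Haar measure becomes the weight of the admissibility condition. -/
theorem lintegral_freqAct (G : Space n → ℝ≥0∞) (hG : Measurable G) (w : Space n) (hw : w 0 ≠ 0) :
    ∫⁻ a : ℝ, ENNReal.ofReal (|a| * rho n a ^ (2 * n - 1) / |a| ^ (2 * n + 1)) *
      ∫⁻ s, G (freqAct a s w) = ∫⁻ v, G v * weight v := by
  set m := 2 * n - 1 with hm
  set H : ℝ → ℝ≥0∞ := fun r => ∫⁻ v, G (consE (two_mul_eq n) (r, v)) with hH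
  have hae : ∀ᵐ a : ℝ, a ≠ 0 := by simp [ae_iff]
  have step1 : ∫⁻ a : ℝ, ENNReal.ofReal (|a| * rho n a ^ m / |a| ^ (2 * n + 1)) *
      ∫⁻ s, G (freqAct a s w) = ∫⁻ a : ℝ,
        (fun b => ENNReal.ofReal (|w 0| * (|b| ^ (2 * n))⁻¹) * H b) (a * w 0) := by
    refine lintegral_congr_ae ?_
    filter_upwards [hae] with a ha
    have hk : kap n a ≠ 0 := by rw [← abs_pos, abs_kap ha]; exact rho_pos ha
    have e := lintegral_comp_smul_add (fun v => G (consE (two_mul_eq n) (a * w 0, v)))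
      (mul_ne_zero hk hw) (kap n a • tailE w)
    have e' : ∀ s, freqAct a s w =
        consE (two_mul_eq n) (a * w 0, (kap n a * w 0) • s + kap n a • tailE w) := by
      intro s; rw [freqAct, smul_add, smul_smul]
    simp_rw [e']
    rw [e, ← mul_assoc, ← ENNReal.ofReal_mul (by have := rho_pos (n := n) ha; positivity)]
    congr 2
    rw [abs_mul, abs_mul, abs_kap ha, mul_pow, mul_pow]
    have h1 := rho_pos (n := n) ha
    have h2 := abs_pos.2 ha
    have h3 := abs_pos.2 hw
    have h4 : |w 0| ^ (2 * n) = |w 0| ^ m * |w 0| := by rw [← pow_succ, hm, ← two_mul_eq]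
    rw [h4]
    field_simp
    rw [pow_succ, hm]
    ring
  rw [step1, lintegral_comp_mul_real
    (fun b => ENNReal.ofReal (|w 0| * (|b| ^ (2 * n))⁻¹) * H b) hw]
  have step2 : ∫⁻ b : ℝ, ENNReal.ofReal (|w 0| * (|b| ^ (2 * n))⁻¹) * H b =
      ENNReal.ofReal |w 0| * ∫⁻ b : ℝ, ENNReal.ofReal (|b| ^ (2 * n))⁻¹ * H b := by
    rw [← lintegral_const_mul' _ _ ENNReal.ofReal_ne_top]
    refine lintegral_congr fun b => ?_
    rw [ENNReal.ofReal_mul (abs_nonneg _), mul_assoc]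
  rw [step2, ← mul_assoc, ← ENNReal.ofReal_mul (by positivity),
    inv_mul_cancel₀ (abs_ne_zero.2 hw), ENNReal.ofReal_one, one_mul]
  have step3 : ∫⁻ v, G v * weight v = ∫⁻ p : ℝ × EuclideanSpace ℝ (Fin m),
      G (consE (two_mul_eq n) p) * weight (consE (two_mul_eq n) p) :=
    ((measurePreserving_consE (two_mul_eq n)).lintegral_comp (hG.mul measurable_weight)).symm
  have hmp : Measurable fun p : ℝ × EuclideanSpace ℝ (Fin m) =>
      G (consE (two_mul_eq n) p) * weight (consE (two_mul_eq n) p) :=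
    (hG.mul measurable_weight).comp (measurable_consE (two_mul_eq n))
  rw [step3, Measure.volume_eq_prod, lintegral_prod _ hmp.aemeasurable]
  refine lintegral_congr_ae ?_
  filter_upwards [hae] with b hb
  have hwt : ∀ v, weight (consE (two_mul_eq n) (b, v)) = ENNReal.ofReal (|b| ^ (2 * n))⁻¹ := by
    intro v
    have : (consE (two_mul_eq n) (b, v) : Space n) 0 = b := by simp [consE]
    rw [weight, this, ENNReal.ofReal_inv_of_pos (by positivity),
      ENNReal.ofReal_pow (abs_nonneg _), ← Real.norm_eq_abs, ofReal_norm]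
  simp_rw [hwt]
  rw [lintegral_mul_const' _ _ ENNReal.ofReal_ne_top, mul_comm]

theorem eLpNorm_two_sq {α G : Type*} [MeasurableSpace α] {μ : Measure α}
    [NormedAddCommGroup G] (g : α → G) : eLpNorm g 2 μ ^ 2 = ∫⁻ x, ‖g x‖ₑ ^ 2 ∂μ := by
  rw [eLpNorm_eq_lintegral_rpow_enorm_toReal (by norm_num) (by norm_num), ← ENNReal.rpow_natCast,
    ← ENNReal.rpow_mul]
  simp

theorem enorm_Lp_sq {α G : Type*} [MeasurableSpace α] {μ : Measure α}
    [NormedAddCommGroup G] (g : Lp G 2 μ) : ‖g‖ₑ ^ 2 = ∫⁻ x, ‖g x‖ₑ ^ 2 ∂μ := by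
  rw [Lp.enorm_def, eLpNorm_two_sq]

/-! ### Shearlets as dilated translates -/

/-- The normalising factor `|a|^{1/(4n) - 1}` of a shearlet. -/
def normFactor (n : ℕ) (a : ℝ) : ℝ := |a| ^ (1 / (4 * (n : ℝ)) - 1)

omit [NeZero n] in
theorem normFactor_sq {a : ℝ} (ha : a ≠ 0) : normFactor n a ^ 2 * |a| ^ 2 = rho n a := by
  have h := abs_pos.2 ha
  rw [normFactor, rho, ← mul_pow, ← Real.rpow_add_one h.ne', ← Real.rpow_natCast,
    ← Real.rpow_mul h.le]
  congr 1
  push_cast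
  ring

/-- The factor `|a|^{1/(4n) - 1}` makes the dilations unitary. -/
theorem normFactor_sq_mul_det {a : ℝ} (ha : a ≠ 0) :
    normFactor n a ^ 2 * (|a| * rho n a ^ (2 * n - 1)) = 1 := by
  have h := abs_pos.2 ha
  have h1 := normFactor_sq (n := n) ha
  have h2 := rho_pow_pred (n := n) a
  have : (normFactor n a ^ 2 * (|a| * rho n a ^ (2 * n - 1))) * |a| = 1 * |a| := by
    calc _ = (normFactor n a ^ 2 * |a| ^ 2) * rho n a ^ (2 * n - 1) := by ring
      _ = _ := by rw [h1, one_mul, mul_comm, h2]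
  exact mul_right_cancel₀ h.ne' this

/-- The linear part `x ↦ S_s A_a x` of the shearlet group. -/
def shearDil (a : {a : ℝ // a ≠ 0}) (s : EuclideanSpace ℝ (Fin (2 * n - 1))) :
    Space n ≃L[ℝ] Space n :=
  matrixEquiv (shearMatrix n s * dilMatrix n a) (isUnit_det (a : ℝ) a.2 s)

/-- The action `w ↦ (S_s A_a)ᵀ w` on frequencies as a linear automorphism. -/
def shearDilTranspose (a : {a : ℝ // a ≠ 0}) (s : EuclideanSpace ℝ (Fin (2 * n - 1))) :
    Space n ≃L[ℝ] Space n :=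
  matrixEquiv (shearMatrix n s * dilMatrix n a).transpose
    (by rw [Matrix.det_transpose]; exact isUnit_det (a : ℝ) a.2 s)

theorem shearDilTranspose_apply (a : {a : ℝ // a ≠ 0})
    (s : EuclideanSpace ℝ (Fin (2 * n - 1))) (w : Space n) :
    shearDilTranspose a s w = freqAct (a : ℝ) s w := by
  rw [shearDilTranspose, matrixEquiv_apply, transpose_act]

theorem abs_det_shearDil (a : {a : ℝ // a ≠ 0}) (s : EuclideanSpace ℝ (Fin (2 * n - 1))) :
    |LinearMap.det (shearDil a s : Space n →ₗ[ℝ] Space n)| =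
      |(a : ℝ)| * rho n a ^ (2 * n - 1) := by
  rw [shearDil, det_matrixEquiv, abs_det _ a.2]

theorem shearlet_eq (ψ : Space n → ℍ[ℝ]) (q : Param n) (x : Space n) :
    shearlet ψ q x = normFactor n q.1 • ψ ((shearDil q.1 q.2.1).symm (x - q.2.2)) := by
  rw [shearlet, shearDil, matrixEquiv_symm_apply, Matrix.mul_inv_rev, normFactor]

theorem memLp_shearlet (ψ : L2H n) (q : Param n) :
    MemLp (shearlet ψ q) 2 (volume : Measure (Space n)) := by
  have h := ((L2Fourier.memLp_comp (shearDil q.1 q.2.1).symm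
    (Lp.memLp ψ)).comp_measurePreserving (measurePreserving_sub_right volume q.2.2)).const_smul
    (normFactor n q.1)
  convert h using 1
  ext1 x
  rw [shearlet_eq]; rfl

theorem lintegral_shearlet (ψ : L2H n) (q : Param n) :
    ∫⁻ x, ‖shearlet ψ q x‖ₑ ^ 2 = ‖ψ‖ₑ ^ 2 := by
  have h1 : ∀ x, ‖shearlet ψ q x‖ₑ ^ 2 = ENNReal.ofReal (normFactor n q.1 ^ 2) *
      (fun y => ‖ψ ((shearDil q.1 q.2.1).symm y)‖ₑ ^ 2) (x - q.2.2) := by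
    intro x
    rw [shearlet_eq, enorm_smul, mul_pow, enorm_sq, Real.norm_eq_abs, sq_abs]
  simp_rw [h1]
  rw [lintegral_const_mul' _ _ ENNReal.ofReal_ne_top, lintegral_sub_right_eq_self
    (fun y => ‖ψ ((shearDil q.1 q.2.1).symm y)‖ₑ ^ 2)]
  have h2 := L2Fourier.lintegral_comp (shearDil q.1 q.2.1)
    (fun y => ‖ψ ((shearDil q.1 q.2.1).symm y)‖ₑ ^ 2)
  simp only [ContinuousLinearEquiv.symm_apply_apply] at h2
  have h3 : normFactor n q.1 ^ 2 = (|(q.1 : ℝ)| * rho n q.1 ^ (2 * n - 1))⁻¹ :=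
    eq_inv_of_mul_eq_one_left (normFactor_sq_mul_det q.1.2)
  rw [enorm_Lp_sq ψ, h2, h3, abs_det_shearDil]

/-- The Cauchy–Schwarz bound for the shearlet transform. -/
theorem enorm_shearletTransform_le (ψ f : L2H n) (q : Param n) :
    ‖shearletTransform ψ f q‖ₑ ^ 2 ≤ ‖f‖ₑ ^ 2 * ‖ψ‖ₑ ^ 2 := by
  have h1 : ‖shearletTransform ψ f q‖ₑ ≤ ∫⁻ x, ‖f x‖ₑ * ‖shearlet ψ q x‖ₑ := by
    refine (enorm_integral_le_lintegral_enorm _).trans (lintegral_mono fun x => ?_)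
    rw [← ofReal_norm, norm_mul, norm_star, ENNReal.ofReal_mul (norm_nonneg _), ofReal_norm,
      ofReal_norm]
  have h2 := ENNReal.lintegral_mul_le_Lp_mul_Lq volume Real.HolderConjugate.two_two
    (f := fun x => ‖f x‖ₑ) (g := fun x => ‖shearlet ψ q x‖ₑ) (Lp.aestronglyMeasurable f).enorm
    (memLp_shearlet ψ q).1.enorm
  have h3 := pow_le_pow_left' (h1.trans h2) 2
  refine h3.trans_eq ?_
  rw [mul_pow, ← ENNReal.rpow_natCast, ← ENNReal.rpow_mul, ← ENNReal.rpow_natCast,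
    ← ENNReal.rpow_mul, ← lintegral_shearlet ψ q, enorm_Lp_sq]
  simp

/-- The Fourier transform of a shearlet. -/
theorem hat_shearlet (ψ : L2H n) (q : Param n) :
    ∀ᵐ w, hat ((memLp_shearlet ψ q).toLp _) w =
      (normFactor n q.1 * (|(q.1 : ℝ)| * rho n q.1 ^ (2 * n - 1))) •
        Real.fourierChar (-⟪q.2.2, w⟫) • hat ψ (freqAct (q.1 : ℝ) q.2.1 w) := by
  have hae : complexifyL2 ((memLp_shearlet ψ q).toLp _) =ᵐ[volume]
      fun x => complexifyL2 (normFactor n q.1 • ψ) ((shearDil q.1 q.2.1).symm (x - q.2.2)) := by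
    have hq : Measure.QuasiMeasurePreserving
        (fun x => (shearDil q.1 q.2.1).symm (x - q.2.2)) volume volume :=
      (L2Fourier.quasiMeasurePreserving (shearDil q.1 q.2.1).symm).comp
        (measurePreserving_sub_right volume q.2.2).quasiMeasurePreserving
    filter_upwards [coeFn_complexifyL2 ((memLp_shearlet ψ q).toLp _),
      (memLp_shearlet ψ q).coeFn_toLp, hq.ae (coeFn_complexifyL2 (normFactor n q.1 • ψ)),
      hq.ae (Lp.coeFn_smul (normFactor n q.1) ψ)] with x h1 h2 h3 h4
    rw [h1, h2, h3, h4, shearlet_eq, Pi.smul_apply]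
  have h := L2Fourier.fourier_affine (shearDil q.1 q.2.1) (shearDilTranspose q.1 q.2.1)
    (fun y w => inner_toEuclideanLin _ y w)
    (by rw [shearDilTranspose, shearDil, det_matrixEquiv, det_matrixEquiv, Matrix.det_transpose])
    q.2.2 _ _ hae
  have hs : (𝓕 (complexifyL2 (normFactor n q.1 • ψ)) : Lp E4 2 (volume : Measure (Space n))) =
      ((normFactor n q.1 : ℝ) : ℂ) • hat ψ := by
    have : complexifyL2 (normFactor n q.1 • ψ) =
        ((normFactor n q.1 : ℝ) : ℂ) • complexifyL2 ψ := by
      rw [map_smul]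
      apply Lp.ext
      filter_upwards [Lp.coeFn_smul (normFactor n q.1) (complexifyL2 ψ),
        Lp.coeFn_smul ((normFactor n q.1 : ℝ) : ℂ) (complexifyL2 ψ)] with x h1 h2
      rw [h1, h2, Pi.smul_apply, Pi.smul_apply, Complex.coe_smul]
    rw [this, FourierTransform.fourier_smul, hat]
  filter_upwards [h, (L2Fourier.quasiMeasurePreserving (shearDilTranspose q.1 q.2.1)).ae
    (Lp.coeFn_smul ((normFactor n q.1 : ℝ) : ℂ) (hat ψ))] with w h1 h2
  rw [hs] at h1
  rw [hat, h1, h2, abs_det_shearDil, Pi.smul_apply, shearDilTranspose_apply, Complex.coe_smul,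
    smul_comm (Real.fourierChar _) (normFactor n (q.1 : ℝ)), smul_smul, mul_comm]

/-! ### The shearlet transform as an inverse Fourier transform -/

theorem norm_mulStar_le_add (u v : E4) : ‖mulStar u v‖ ≤ ‖u‖ ^ 2 + ‖v‖ ^ 2 := by
  refine abs_le_of_sq_le_sq' ?_ (by positivity) |>.2
  have := norm_mulStar_le u v
  nlinarith [sq_nonneg (‖u‖ ^ 2 - ‖v‖ ^ 2), sq_nonneg (‖u‖ ^ 2), sq_nonneg (‖v‖ ^ 2)]

omit [NeZero n] in
theorem integrable_mulStar {u v : Space n → E4} (hu : MemLp u 2) (hv : MemLp v 2) :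
    Integrable (fun x => mulStar (u x) (v x)) := by
  refine Integrable.mono' ((hu.integrable_norm_pow (by norm_num)).add
    (hv.integrable_norm_pow (by norm_num))) ?_ (.of_forall fun x => norm_mulStar_le_add _ _)
  have h := Continuous.comp_aestronglyMeasurable (f := fun x => (u x, v x)) continuous_mulStar
    (hu.1.prodMk hv.1)
  exact h

omit [NeZero n] in
/-- Parseval's formula for the product `u * star v`. -/
theorem integral_mulStar_fourier (u v : Lp E4 2 (volume : Measure (Space n))) :
    ∫ x, mulStar (u x) (v x) = ∫ w, mulStar ((𝓕 u : Lp E4 2 (volume : Measure (Space n))) w)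
      ((𝓕 v : Lp E4 2 (volume : Measure (Space n))) w) := by
  have comp : ∀ (u v : Lp E4 2 (volume : Measure (Space n))) (m : Fin 4),
      (∫ x, mulStar (u x) (v x)) m = inner ℂ v ((leftMulStar m).compLpL 2 volume u) := by
    intro u v m
    have h1 := (EuclideanSpace.proj m : E4 →L[ℂ] ℂ).integral_comp_comm
      (integrable_mulStar (Lp.memLp u) (Lp.memLp v))
    refine h1.symm.trans ?_
    rw [L2.inner_def]
    refine integral_congr_ae ?_
    filter_upwards [(leftMulStar m).coeFn_compLpL u] with x hx
    rw [hx]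
    rfl
  ext m
  rw [comp, comp, ← L2Fourier.fourier_compLpL, Lp.inner_fourier_eq]

/-- The product of Fourier transforms whose inverse Fourier transform is `t ↦ SH(a, s, t)`. -/
def spectralProduct (ψ f : L2H n) (a : ℝ) (s : EuclideanSpace ℝ (Fin (2 * n - 1)))
    (w : Space n) : E4 :=
  (normFactor n a * (|a| * rho n a ^ (2 * n - 1))) • mulStar (hat f w) (hat ψ (freqAct a s w))

theorem integrable_spectralProduct (ψ f : L2H n) (a : {a : ℝ // a ≠ 0})
    (s : EuclideanSpace ℝ (Fin (2 * n - 1))) :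
    Integrable (spectralProduct ψ f a s) := by
  have h : MemLp (fun w => hat ψ (freqAct (a : ℝ) s w)) 2 volume := by
    simp_rw [← shearDilTranspose_apply]
    exact L2Fourier.memLp_comp _ (Lp.memLp _)
  exact (integrable_mulStar (Lp.memLp (hat f)) h).smul
    (normFactor n (a : ℝ) * (|(a : ℝ)| * rho n a ^ (2 * n - 1)))

/-- As a function of the translation parameter, the shearlet transform is the inverse Fourier
integral of the integrable function `spectralProduct ψ f a s`. -/
theorem complexify_shearletTransform (ψ f : L2H n) (q : Param n) :
    complexify (shearletTransform ψ f q) = 𝓕⁻ (spectralProduct ψ f q.1 q.2.1) q.2.2 := by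
  set Ψ := (memLp_shearlet ψ q).toLp _ with hΨ
  have e1 : ∀ᵐ x, complexify (f x * star (shearlet ψ q x)) =
      mulStar (complexifyL2 f x) (complexifyL2 Ψ x) := by
    filter_upwards [coeFn_complexifyL2 f, coeFn_complexifyL2 Ψ,
      (memLp_shearlet ψ q).coeFn_toLp] with x h1 h2 h3
    rw [complexify_mul_star, h1, h2, h3]
  have hint : Integrable (fun x => f x * star (shearlet ψ q x)) := by
    refine Integrable.mono' (((Lp.memLp f).integrable_norm_pow (by norm_num)).add
      ((memLp_shearlet ψ q).integrable_norm_pow (by norm_num))) ?_ (.of_forall fun x => ?_)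
    · exact (Lp.aestronglyMeasurable f).mul (memLp_shearlet ψ q).1.star
    · rw [norm_mul, norm_star, Pi.add_apply]
      nlinarith [sq_nonneg (‖f x‖ - ‖shearlet ψ q x‖), sq_nonneg ‖f x‖,
        sq_nonneg ‖shearlet ψ q x‖]
  rw [shearletTransform, ← complexify.integral_comp_comm hint, integral_congr_ae e1,
    integral_mulStar_fourier, Real.fourierInv_eq]
  refine integral_congr_ae ?_
  filter_upwards [hat_shearlet ψ q] with w hw
  change mulStar (hat f w) (hat Ψ w) = _
  rw [hΨ, hw, spectralProduct, Circle.smul_def, Circle.smul_def, ← Complex.coe_smul,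
    mulStar_smul_right, mulStar_smul_right, Complex.conj_ofReal, AddChar.map_neg_eq_inv,
    Circle.coe_inv_eq_conj, Complex.conj_conj, smul_comm, real_inner_comm, Complex.coe_smul]

/-- Plancherel's formula in the translation variable. Square integrability of the spectral product
is assumed; it holds for almost every `(a, s)` when `ψ` is admissible. -/
theorem lintegral_shearletTransform_translation (ψ f : L2H n) (a : {a : ℝ // a ≠ 0})
    (s : EuclideanSpace ℝ (Fin (2 * n - 1)))
    (h : ∫⁻ w, ‖spectralProduct ψ f a s w‖ₑ ^ 2 < ∞) :
    ∫⁻ t, ‖shearletTransform ψ f (a, s, t)‖ₑ ^ 2 = ∫⁻ w, ‖spectralProduct ψ f a s w‖ₑ ^ 2 := by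
  have hi := integrable_spectralProduct ψ f a s
  have hm : MemLp (spectralProduct ψ f a s) 2 (volume : Measure (Space n)) := by
    refine ⟨hi.1, ?_⟩
    rw [← eLpNorm_two_sq] at h
    by_contra hc
    rw [not_lt, top_le_iff] at hc
    simp [hc] at h
  rw [← eLpNorm_two_sq, ← eLpNorm_two_sq, ← L2Fourier.eLpNorm_fourierInv _ hi hm]
  congr 1
  refine eLpNorm_congr_norm_ae (.of_forall fun t => ?_)
  rw [← complexify_shearletTransform ψ f (a, s, t), norm_complexify]

/-! ### Measurability and Plancherel's formula for the shearlet transform -/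

theorem measurable_matrix_inv_apply {N : ℕ} {α : Type*} [MeasurableSpace α]
    {M : α → Matrix (Fin N) (Fin N) ℝ} (hM : ∀ i j, Measurable fun x => M x i j) (i j : Fin N) :
    Measurable fun x => (M x)⁻¹ i j := by
  have hM' : Measurable fun x : α => (fun i j => M x i j : Fin N → Fin N → ℝ) :=
    measurable_pi_lambda _ fun i => measurable_pi_lambda _ fun j => hM i j
  have h1 : Continuous fun A : Fin N → Fin N → ℝ => (Matrix.of A).det :=
    Continuous.matrix_det continuous_id
  have h2 : Continuous fun A : Fin N → Fin N → ℝ => (Matrix.of A).adjugate i j :=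
    (Continuous.matrix_adjugate continuous_id).matrix_elem i j
  have h3 : (fun x => (M x)⁻¹ i j) = fun x => (M x).det⁻¹ * (M x).adjugate i j := by
    ext x; rw [Matrix.inv_def, Ring.inverse_eq_inv', Matrix.smul_apply, smul_eq_mul]
  rw [h3]
  exact (h1.measurable.comp hM').inv.mul (h2.measurable.comp hM')

omit [NeZero n] in
theorem measurable_shearlet_arg :
    Measurable fun p : Param n × Space n =>
      Matrix.toEuclideanLin ((dilMatrix n p.1.1)⁻¹ * (shearMatrix n p.1.2.1)⁻¹)
        (p.2 - p.1.2.2) := by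
  have ha : Measurable fun p : Param n × Space n => (p.1.1 : ℝ) := by fun_prop
  have hA : ∀ i j, Measurable fun p : Param n × Space n => dilMatrix n (p.1.1 : ℝ) i j := by
    intro i j
    simp only [dilMatrix, Matrix.diagonal_apply]
    split_ifs
    · exact ha
    · exact measurable_kap.comp ha
    · exact measurable_const
  have hS : ∀ i j, Measurable fun p : Param n × Space n => shearMatrix n p.1.2.1 i j := by
    intro i j
    simp only [shearMatrix, Matrix.of_apply]
    split_ifs <;> fun_prop
  have hA' := measurable_matrix_inv_apply hA
  have hS' := measurable_matrix_inv_apply hS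
  simp only [Matrix.toLpLin_apply]
  refine (PiLp.continuous_toLp 2 _).measurable.comp (measurable_pi_lambda _ fun i => ?_)
  simp only [Matrix.mulVec, dotProduct, Matrix.mul_apply]
  refine Finset.measurable_sum _ fun j _ => Measurable.mul ?_ ?_
  · exact Finset.measurable_sum _ fun k _ => (hA' i k).mul (hS' k j)
  · fun_prop

omit [NeZero n] in
theorem stronglyMeasurable_shearletTransform (ψ f : L2H n) :
    StronglyMeasurable (shearletTransform ψ f) := by
  refine StronglyMeasurable.integral_prod_right
    (f := fun (q : Param n) (x : Space n) => f x * star (shearlet ψ q x)) ?_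
  have h1 : StronglyMeasurable fun p : Param n × Space n => f p.2 :=
    (Lp.stronglyMeasurable f).comp_measurable measurable_snd
  have h2 := (Lp.stronglyMeasurable ψ).comp_measurable (measurable_shearlet_arg (n := n))
  have h3 : Measurable fun p : Param n × Space n => normFactor n (p.1.1 : ℝ) := by
    unfold normFactor; fun_prop
  exact h1.mul (h3.stronglyMeasurable.smul h2).star

theorem measurable_freqAct :
    Measurable fun p : (Space n × ℝ) × EuclideanSpace ℝ (Fin (2 * n - 1)) =>
      freqAct p.1.2 p.2 p.1.1 := by
  refine (measurable_consE (two_mul_eq n)).comp (Measurable.prodMk (by fun_prop) ?_)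
  refine Measurable.smul (measurable_kap.comp (by fun_prop)) (Measurable.add (by fun_prop) ?_)
  refine (PiLp.continuous_toLp 2 _).measurable.comp (measurable_pi_lambda _ fun i => ?_)
  fun_prop

theorem ae_coord_ne_zero : ∀ᵐ w : Space n, w 0 ≠ 0 := by
  have hs : MeasurableSet {w : Space n | w 0 = 0} :=
    measurableSet_eq_fun (by fun_prop) measurable_const
  have h := (measurePreserving_consE (two_mul_eq n)).measure_preimage hs.nullMeasurableSet
  have h2 : consE (two_mul_eq n) ⁻¹' {w : Space n | w 0 = 0} = {0} ×ˢ Set.univ := by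
    ext p; simp [consE]
  rw [h2, Measure.volume_eq_prod, Measure.prod_prod, Real.volume_singleton, zero_mul] at h
  rw [ae_iff]
  simpa using h.symm

omit [NeZero n] in
theorem enorm_hat (f : L2H n) : ‖hat f‖ₑ = ‖f‖ₑ := by
  rw [← ofReal_norm, norm_hat, ofReal_norm]

theorem stronglyMeasurable_mulStar_freqAct (ψ f : L2H n) :
    StronglyMeasurable fun p : (Space n × ℝ) × EuclideanSpace ℝ (Fin (2 * n - 1)) =>
      mulStar (hat f p.1.1) (hat ψ (freqAct p.1.2 p.2 p.1.1)) := by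
  have h1 := (Lp.stronglyMeasurable (hat f)).comp_measurable
    (measurable_fst.comp measurable_fst :
      Measurable fun p : (Space n × ℝ) × EuclideanSpace ℝ (Fin (2 * n - 1)) => p.1.1)
  have h2 := (Lp.stronglyMeasurable (hat ψ)).comp_measurable (measurable_freqAct (n := n))
  exact Continuous.comp_stronglyMeasurable (f := fun p : (Space n × ℝ) ×
    EuclideanSpace ℝ (Fin (2 * n - 1)) => (hat f p.1.1, hat ψ (freqAct p.1.2 p.2 p.1.1)))
    continuous_mulStar (h1.prodMk h2)

theorem stronglyMeasurable_spectralProduct (ψ f : L2H n) :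
    StronglyMeasurable fun q : (ℝ × EuclideanSpace ℝ (Fin (2 * n - 1))) × Space n =>
      spectralProduct ψ f q.1.1 q.1.2 q.2 := by
  have h1 : Measurable (normFactor n) := by unfold normFactor; fun_prop
  have h2 : Measurable fun q : (ℝ × EuclideanSpace ℝ (Fin (2 * n - 1))) × Space n =>
      normFactor n q.1.1 * (|q.1.1| * rho n q.1.1 ^ (2 * n - 1)) := by
    have := measurable_rho (n := n)
    fun_prop
  have hp : Measurable fun q : (ℝ × EuclideanSpace ℝ (Fin (2 * n - 1))) × Space n =>
      ((q.2, q.1.1), q.1.2) := by fun_prop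
  have h3 := (stronglyMeasurable_mulStar_freqAct ψ f).comp_measurable hp
  exact h2.stronglyMeasurable.smul h3

theorem enorm_spectralProduct (ψ f : L2H n) {a : ℝ} (ha : a ≠ 0)
    (s : EuclideanSpace ℝ (Fin (2 * n - 1))) (w : Space n) :
    ‖spectralProduct ψ f a s w‖ₑ ^ 2 = ENNReal.ofReal (|a| * rho n a ^ (2 * n - 1)) *
      ‖mulStar (hat f w) (hat ψ (freqAct a s w))‖ₑ ^ 2 := by
  have h : (normFactor n a * (|a| * rho n a ^ (2 * n - 1))) ^ 2 =
      |a| * rho n a ^ (2 * n - 1) := by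
    calc _ = (normFactor n a ^ 2 * (|a| * rho n a ^ (2 * n - 1))) *
          (|a| * rho n a ^ (2 * n - 1)) := by ring
      _ = _ := by rw [normFactor_sq_mul_det ha, one_mul]
  rw [spectralProduct, enorm_smul, mul_pow, enorm_sq (normFactor n a * _), Real.norm_eq_abs,
    sq_abs, h]

theorem measurable_lintegral_spectralProduct (ψ f : L2H n) :
    Measurable fun p : ℝ × EuclideanSpace ℝ (Fin (2 * n - 1)) =>
      ENNReal.ofReal (1 / |p.1| ^ (2 * n + 1)) *
        ∫⁻ w, ‖spectralProduct ψ f p.1 p.2 w‖ₑ ^ 2 := by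
  have h1 : Measurable fun p : ℝ × EuclideanSpace ℝ (Fin (2 * n - 1)) =>
      ENNReal.ofReal (1 / |p.1| ^ (2 * n + 1)) := by fun_prop
  have h2 := ((stronglyMeasurable_spectralProduct ψ f).enorm.pow_const 2).lintegral_prod_right'
    (ν := (volume : Measure (Space n)))
  exact h1.mul h2

/-- The integral of the spectral products over the shearlet group. -/
theorem lintegral_spectralProduct (ψ f : L2H n) :
    ∫⁻ a : ℝ, ∫⁻ s, ENNReal.ofReal (1 / |a| ^ (2 * n + 1)) *
      ∫⁻ w, ‖spectralProduct ψ f a s w‖ₑ ^ 2 = ‖f‖ₑ ^ 2 * admConst ψ := by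
  set c : ℝ → ℝ≥0∞ := fun a => ENNReal.ofReal (|a| * rho n a ^ (2 * n - 1) / |a| ^ (2 * n + 1))
    with hc
  have hcm : Measurable c := by
    have := measurable_rho (n := n)
    simp only [hc]; fun_prop
  set g : Space n → ℝ → EuclideanSpace ℝ (Fin (2 * n - 1)) → ℝ≥0∞ := fun w a s =>
    c a * ‖mulStar (hat f w) (hat ψ (freqAct a s w))‖ₑ ^ 2 with hg
  have hgm : Measurable fun p : (Space n × ℝ) × EuclideanSpace ℝ (Fin (2 * n - 1)) =>
      g p.1.1 p.1.2 p.2 :=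
    (hcm.comp (measurable_snd.comp measurable_fst)).mul
      ((stronglyMeasurable_mulStar_freqAct ψ f).enorm.pow_const 2)
  have e1 : ∫⁻ a : ℝ, ∫⁻ s, ENNReal.ofReal (1 / |a| ^ (2 * n + 1)) *
      ∫⁻ w, ‖spectralProduct ψ f a s w‖ₑ ^ 2 = ∫⁻ a : ℝ, ∫⁻ s, ∫⁻ w, g w a s := by
    have hae : ∀ᵐ a : ℝ, a ≠ 0 := by simp [ae_iff]
    refine lintegral_congr_ae ?_
    filter_upwards [hae] with a ha
    refine lintegral_congr fun s => ?_
    rw [← lintegral_const_mul' _ _ ENNReal.ofReal_ne_top]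
    refine lintegral_congr fun w => ?_
    have := rho_pos (n := n) ha
    rw [enorm_spectralProduct ψ f ha, ← mul_assoc, ← ENNReal.ofReal_mul (by positivity),
      one_div_mul_eq_div]
  -- Tonelli moves the frequency integral outside the integral over the group.
  have e2 : ∀ a : ℝ, ∫⁻ s, ∫⁻ w, g w a s = ∫⁻ w, ∫⁻ s, g w a s := fun a =>
    lintegral_lintegral_swap (hgm.comp ((measurable_snd.prodMk measurable_const).prodMk
      measurable_fst)).aemeasurable
  have e3 : ∫⁻ a : ℝ, ∫⁻ w, ∫⁻ s, g w a s = ∫⁻ w, ∫⁻ a : ℝ, ∫⁻ s, g w a s :=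
    lintegral_lintegral_swap (hgm.lintegral_prod_right'.comp measurable_swap).aemeasurable
  rw [e1]
  simp_rw [e2]
  rw [e3, ← enorm_hat, enorm_Lp_sq, ← lintegral_mul_const _
    ((Lp.stronglyMeasurable (hat f)).enorm.pow_const 2)]
  refine lintegral_congr_ae ?_
  filter_upwards [ae_coord_ne_zero (n := n)] with w hw
  rw [← lintegral_mulStar ψ (hat f w), ← lintegral_freqAct
    (fun v => ‖mulStar (hat f w) (hat ψ v)‖ₑ ^ 2) ?_ w hw]
  · refine lintegral_congr fun a => ?_
    exact lintegral_const_mul' _ _ ENNReal.ofReal_ne_top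
  · exact ((continuous_mulStar_right (hat f w)).comp_stronglyMeasurable
      (Lp.stronglyMeasurable (hat ψ))).enorm.pow_const 2

omit [NeZero n] in
theorem ae_ae_lt_top {α β : Type*} [MeasurableSpace α] [MeasurableSpace β] {μ : Measure α}
    {ν : Measure β} [SFinite ν] {K : α × β → ℝ≥0∞} (hK : Measurable K)
    (h : ∫⁻ a, ∫⁻ b, K (a, b) ∂ν ∂μ ≠ ∞) : ∀ᵐ a ∂μ, ∀ᵐ b ∂ν, K (a, b) < ∞ := by
  filter_upwards [ae_lt_top hK.lintegral_prod_right' h] with a ha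
  exact ae_lt_top (hK.comp measurable_prodMk_left) ha.ne

/-- Plancherel's formula for the shearlet transform. -/
theorem lintegral_shearletTransform (ψ f : L2H n) (hadm : Admissible ψ) :
    ∫⁻ q, ‖shearletTransform ψ f q‖ₑ ^ 2 ∂(haarMeasure n) = ‖f‖ₑ ^ 2 * admConst ψ := by
  set κ : Measure {a : ℝ // a ≠ 0} := (volume : Measure ℝ).comap Subtype.val with hκ
  have hFm : Measurable fun q : Param n => ‖shearletTransform ψ f q‖ₑ ^ 2 :=
    (stronglyMeasurable_shearletTransform ψ f).enorm.pow_const 2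
  have hdm : Measurable fun q : Param n =>
      ENNReal.ofReal (1 / |(q.1 : ℝ)| ^ (2 * n + 1)) := by fun_prop
  obtain ⟨K, hK⟩ : ∃ K : ℝ × EuclideanSpace ℝ (Fin (2 * n - 1)) → ℝ≥0∞, K = fun p =>
    ENNReal.ofReal (1 / |p.1| ^ (2 * n + 1)) * ∫⁻ w, ‖spectralProduct ψ f p.1 p.2 w‖ₑ ^ 2 :=
    ⟨_, rfl⟩
  have hKm : Measurable K := by rw [hK]; exact measurable_lintegral_spectralProduct ψ f
  have hKint : ∫⁻ a : {a : ℝ // a ≠ 0}, (∫⁻ s, K (a, s)) ∂κ = ‖f‖ₑ ^ 2 * admConst ψ := by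
    rw [← lintegral_spectralProduct ψ f]
    have hs : MeasurableSet {a : ℝ | a ≠ 0} := (measurableSet_singleton 0).compl
    have h := lintegral_subtype_comap (μ := volume) hs (fun a : ℝ => ∫⁻ s, K (a, s))
    refine h.trans ?_
    rw [Measure.restrict_eq_self_of_ae_mem (by simp [ae_iff]), hK]
  have hcoe : Measurable fun p : {a : ℝ // a ≠ 0} × EuclideanSpace ℝ (Fin (2 * n - 1)) =>
      ((p.1 : ℝ), p.2) := by fun_prop
  -- Admissibility makes almost every spectral product square integrable, which is what allows
  -- Plancherel's formula to be applied in the translation variable.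
  have hfin : ∀ᵐ a : {a : ℝ // a ≠ 0} ∂κ, ∀ᵐ s, K (a, s) < ∞ := by
    refine ae_ae_lt_top (hKm.comp hcoe) ?_
    change ∫⁻ a : {a : ℝ // a ≠ 0}, (∫⁻ s, K (a, s)) ∂κ ≠ ∞
    rw [hKint]
    exact ENNReal.mul_ne_top (by simp) hadm.ne
  obtain ⟨G, hG⟩ : ∃ G : {a : ℝ // a ≠ 0} → EuclideanSpace ℝ (Fin (2 * n - 1)) → Space n →
    ℝ≥0∞, G = fun (a : {a : ℝ // a ≠ 0}) s t =>
      ENNReal.ofReal (1 / |(a : ℝ)| ^ (2 * n + 1)) *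
      ‖shearletTransform ψ f (a, s, t)‖ₑ ^ 2 := ⟨_, rfl⟩
  have hGm : Measurable fun q : Param n => G q.1 q.2.1 q.2.2 := by
    rw [hG]; exact hdm.mul hFm
  have e1 : ∫⁻ q, ‖shearletTransform ψ f q‖ₑ ^ 2 ∂(haarMeasure n) =
      ∫⁻ q : Param n, G q.1 q.2.1 q.2.2 ∂(κ.prod (volume.prod volume)) := by
    rw [hG]; exact lintegral_withDensity_eq_lintegral_mul _ hdm hFm
  have e2 := lintegral_prod (μ := κ)
    (ν := (volume : Measure (EuclideanSpace ℝ (Fin (2 * n - 1)))).prod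
      (volume : Measure (Space n)))
    (fun q : Param n => G q.1 q.2.1 q.2.2) hGm.aemeasurable
  rw [e1, e2, ← hKint]
  refine lintegral_congr_ae ?_
  filter_upwards [hfin] with a ha
  have hGa : Measurable fun y : EuclideanSpace ℝ (Fin (2 * n - 1)) × Space n => G a y.1 y.2 :=
    hGm.comp (measurable_prodMk_left (x := a))
  have e3 := lintegral_prod (μ := (volume : Measure (EuclideanSpace ℝ (Fin (2 * n - 1)))))
    (ν := (volume : Measure (Space n)))
    (fun y : EuclideanSpace ℝ (Fin (2 * n - 1)) × Space n => G a y.1 y.2) hGa.aemeasurable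
  refine e3.trans ?_
  refine lintegral_congr_ae ?_
  filter_upwards [ha] with s hs
  have hpos : ENNReal.ofReal (1 / |(a : ℝ)| ^ (2 * n + 1)) ≠ 0 := by
    have := abs_pos.2 a.2
    rw [Ne, ENNReal.ofReal_eq_zero, not_le]
    positivity
  have hlt : ∫⁻ w, ‖spectralProduct ψ f a s w‖ₑ ^ 2 < ∞ := by
    by_contra hc
    rw [not_lt, top_le_iff] at hc
    simp only [hK, hc, ENNReal.mul_top hpos, lt_self_iff_false] at hs
  simp only [hG, hK]
  rw [lintegral_const_mul' _ _ ENNReal.ofReal_ne_top,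
    lintegral_shearletTransform_translation ψ f a s hlt]

end

end QuatShearlet

theorem mainTheorem6 (n : ℕ) [NeZero n]
    (ψ : QuatShearlet.L2H n) (hψ : ψ ≠ 0) (hadm : QuatShearlet.Admissible ψ)
    (f : QuatShearlet.L2H n) (hf : f ≠ 0)
    (S : Set (QuatShearlet.Param n)) (hS : MeasurableSet S)
    (ξ : ℝ) (hξ0 : 0 ≤ ξ) (hξ1 : ξ ≤ 1)
    (hconc : QuatShearlet.Concentrated ξ (QuatShearlet.shearletTransform ψ f) S)
    (p : ℝ) (hp : 2 < p) :
    ENNReal.ofReal ((1 - ξ ^ 2) ^ (p / (p - 2))) * (QuatShearlet.admConst ψ / ‖ψ‖ₑ ^ 2)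
      ≤ QuatShearlet.haarMeasure n S := by
  have hT := QuatShearlet.lintegral_shearletTransform ψ f hadm
  set F := QuatShearlet.shearletTransform ψ f with hF
  set μ := QuatShearlet.haarMeasure n with hμ
  set T := ∫⁻ q, ‖F q‖ₑ ^ 2 ∂μ with hTdef
  have hf0 : ‖f‖ₑ ^ 2 ≠ 0 := by simpa using hf
  have hψ0 : ‖ψ‖ₑ ^ 2 ≠ 0 := by simpa using hψ
  have hTfin : T ≠ ⊤ := by
    rw [hT]; exact ENNReal.mul_ne_top (by simp) hadm.ne
  have hS1 : ∫⁻ q in S, ‖F q‖ₑ ^ 2 ∂μ ≤ ‖f‖ₑ ^ 2 * ‖ψ‖ₑ ^ 2 * μ S := by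
    refine (MeasureTheory.lintegral_mono fun q =>
      QuatShearlet.enorm_shearletTransform_le ψ f q).trans ?_
    simp
  have hS2 : ∫⁻ q in Sᶜ, ‖F q‖ₑ ^ 2 ∂μ ≤ ENNReal.ofReal (ξ ^ 2) * T := by
    have h := ENNReal.rpow_le_rpow (z := 2) hconc (by norm_num)
    rw [ENNReal.mul_rpow_of_nonneg _ _ (by norm_num), ← ENNReal.rpow_mul, ← ENNReal.rpow_mul,
      ENNReal.ofReal_rpow_of_nonneg hξ0 (by norm_num)] at h
    norm_num at h
    exact h
  have hsum : T = ∫⁻ q in S, ‖F q‖ₑ ^ 2 ∂μ + ∫⁻ q in Sᶜ, ‖F q‖ₑ ^ 2 ∂μ :=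
    (MeasureTheory.lintegral_add_compl _ hS).symm
  have hξ2 : ξ ^ 2 ≤ 1 := pow_le_one₀ hξ0 hξ1
  have hmain : ENNReal.ofReal (1 - ξ ^ 2) * T ≤ ‖f‖ₑ ^ 2 * ‖ψ‖ₑ ^ 2 * μ S := by
    rw [ENNReal.ofReal_sub _ (sq_nonneg ξ), ENNReal.ofReal_one,
      ENNReal.sub_mul (fun _ _ => hTfin), one_mul, tsub_le_iff_right]
    calc T = _ := hsum
      _ ≤ _ := add_le_add hS1 hS2
  rw [hT, mul_left_comm, mul_assoc, ENNReal.mul_le_mul_iff_right hf0 (by simp)] at hmain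
  -- The exponent `p / (p - 2)` exceeds one, and the base lies in `[0, 1]`.
  have hpow : (1 - ξ ^ 2) ^ (p / (p - 2)) ≤ 1 - ξ ^ 2 := by
    have h1 : 1 ≤ p / (p - 2) := by rw [le_div_iff₀ (by linarith)]; linarith
    simpa using Real.rpow_le_rpow_of_exponent_ge' (by linarith) (by nlinarith) zero_le_one h1
  rw [← mul_div_assoc, ENNReal.div_le_iff hψ0 (by simp), mul_comm (μ S)]
  exact (mul_le_mul_left (ENNReal.ofReal_le_ofReal hpow) _).trans hmain
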